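/- For $N\ge 1$ let $\boldsymbol y=(y_e)$ be the edge indicators of the random graph $G(N,1/2)$, i.e. $\binom N2$ i.i.d. $\mathrm{Ber}(1/2)$ variables indexed by the unordered pairs of distinct elements of $[N]=\{1,\dots,N\}$, and let $\omega$ be a random variable independent of $\boldsymbol y$, taking values in some measurable space $\Omega_N$. A function $g:\{0,1\}^{\binom N2}\to\mathbb R$ is a *degree $D$ function* if it lies in the linear span of the functions $y\mapsto\prod_{e\in I}f_e(y_e)$ with $|I|\le D$ and arbitrary $f_e:\{0,1\}\to\mathbb R$. A measurable map $\mathcal A^\circ=\mathcal A^\circ_N:\{0,1\}^{\binom N2}\times\Omega_N\to\mathbb R^N$ is a degree $D$ function if, for every fixed $\omega$, each of its $N$ coordinates is a degree $D$ function of $y$. Define $\mathsf{round}:\mathbb R\to\{0,1,*\}$ by $\mathsf{round}(z)=0$ if $|z|\le 1/2$, $\mathsf{round}(z)=1$ if $|z|\ge 1$, and $\mathsf{round}(z)=*$ otherwise, and apply it entrywise to vectors. For $b>0$, a function $F:\{0,1,*\}^N\times\{0,1\}^{\binom N2}\to\mathcal P([N])\cup\{\mathsf{err}\}$ is *$b$-repairing*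 if, whenever $F(z,y)=S\ne\mathsf{err}$, the set $S$ is an independent set of the graph $y$ and the Hamming distance $|\{i\in[N]:(\mathbb 1_S)_i\ne z_i\}|$ is at most $b\log_2 N$. **Corollary.** For every $\iota>0$ there exists $b>0$ such that the following holds. Let $C$ be a constant, let $D=D(N)=o(\log^2 N)$, and for each $N$ let $\mathcal A^\circ_N$ be a degree $D(N)$ function such that $\mathbb E\big[\|\mathcal A^\circ_N(\boldsymbol y,\omega)\|^2\big]\le C\log N$ for all sufficiently large $N$. For each $N$ let $F_N$ be an arbitrary $b$-repairing function, and put $\mathcal A_N(\boldsymbol y,\omega)=F_N\big(\mathsf{round}(\mathcal A^\circ_N(\boldsymbol y,\omega)),\boldsymbol y\big)$. Then, as $N\to\infty$, $$\mathbb P\big[\mathcal A_N(\boldsymbol y,\omega)\text{ is an independent set of }\boldsymbol y\text{ of size at least }(1+\iota)\log_2 N\big]=o(1).$$ -/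

import Mathlib

open MeasureTheory ProbabilityTheory Filter Topology Asymptotics

namespace DenseIndSet

/-- The `N.choose 2` unordered pairs of distinct vertices of `[N]`. -/
abbrev Pair (N : ℕ) : Type := {e : Sym2 (Fin N) // ¬ e.IsDiag}

/-- An element of `{0,1}^(N choose 2)`: a graph on `[N]`, given by the indicators of its edges. -/
abbrev Input (N : ℕ) : Type := Pair N → Bool

/-- The graph on `[N]` encoded by `y`. -/
def graph {N : ℕ} (y : Input N) : SimpleGraph (Fin N) :=
  SimpleGraph.fromEdgeSet {e | ∃ h : ¬ e.IsDiag, y ⟨e, h⟩ = true}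

/-- The probability `1/2`. -/
noncomputable def half : unitInterval := ⟨1 / 2, Set.mem_Icc.2 (by norm_num)⟩

/-- The law of `G(N, 1/2)`: the entries of `y` are i.i.d. Bernoulli variables of parameter `1/2`. -/
noncomputable def gnpHalf (N : ℕ) : Measure (Input N) :=
  Measure.pi fun _ => bernoulliMeasure true false half

/-- The space of degree `D` functions on `Γ^d`: the linear span of the functions
`y ↦ ∏ i ∈ I, f i (y i)` with `|I| ≤ D` and arbitrary `f i : Γ → ℝ`. -/
def degreeFunctions (d Γ : Type*) (D : ℕ) : Submodule ℝ ((d → Γ) → ℝ) :=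
  Submodule.span ℝ {g | ∃ (I : Finset d) (f : d → Γ → ℝ), I.card ≤ D ∧
    g = fun y => ∏ i ∈ I, f i (y i)}

/-- `A(y, ω)` is a degree `D` function: for every fixed `ω`, each of its `N` output coordinates is
a degree `D` function of `y`. -/
def IsDegree {N : ℕ} {Ω : Type*} (A : Input N → Ω → EuclideanSpace ℝ (Fin N)) (D : ℕ) : Prop :=
  ∀ ω i, (fun y => A y ω i) ∈ degreeFunctions (Pair N) Bool D

/-- Rounding of a real number to `{0, 1, *}`, where `0`, `1`, `*` are `some false`, `some true`,
`none`. -/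
noncomputable def roundEntry (z : ℝ) : Option Bool :=
  if |z| ≤ 1 / 2 then some false else if 1 ≤ |z| then some true else none

/-- Entrywise rounding of a vector. -/
noncomputable def roundVec {N : ℕ} (z : EuclideanSpace ℝ (Fin N)) : Fin N → Option Bool :=
  fun i => roundEntry (z i)

/-- The indicator vector of `S`, as an element of `{0, 1, *}^N`. -/
def indicatorVec {N : ℕ} (S : Finset (Fin N)) : Fin N → Option Bool :=
  fun i => some (decide (i ∈ S))

/-- `F : {0,1,*}^N × {0,1}^(N choose 2) → 𝒫([N]) ∪ {err}` (with `err` being `none`) is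
`b`-repairing: whenever it outputs a set `S`, this is an independent set of `y` whose indicator
vector is within Hamming distance `b log₂ N` of the rounded vector `z`. -/
def IsRepairing {N : ℕ} (b : ℝ)
    (F : (Fin N → Option Bool) → Input N → Option (Finset (Fin N))) : Prop :=
  ∀ z y S, F z y = some S →
    (graph y).IsIndepSet (S : Set (Fin N)) ∧
      (hammingDist (indicatorVec S) z : ℝ) ≤ b * Real.logb 2 N

/-- The final output `F(round(A(y, ω)), y)`. -/
noncomputable def output {N : ℕ} {Ω : Type*} (A : Input N → Ω → EuclideanSpace ℝ (Fin N))
    (F : (Fin N → Option Bool) → Input N → Option (Finset (Fin N)))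
    (y : Input N) (ω : Ω) : Option (Finset (Fin N)) :=
  F (roundVec (A y ω)) y

/-- The output `o` is (a set, not `err`, and) an independent set of `y` of size at least
`(1 + ι) log₂ N`. -/
def IsLargeIndepSet {N : ℕ} (ι : ℝ) (y : Input N) (o : Option (Finset (Fin N))) : Prop :=
  ∃ S, o = some S ∧ (graph y).IsIndepSet (S : Set (Fin N)) ∧
    (1 + ι) * Real.logb 2 N ≤ (S.card : ℝ)

end DenseIndSet

/-!
Consider a random path of `2 ^ j` steps, of order `D + 1`, through copies of `G(N, 1/2)` in which
consecutive copies are `ρ`-correlated with `1 - ρ` of order `1 / (D + 1)`. A degree `D` function of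
bounded energy moves little along a typical step. The steps along which it moves little and that
join two successful inputs form a symmetric kernel, for which paths of length `2 ^ j` satisfy a
Sidorenko inequality. A success probability bounded below thus makes all inputs of the path
successful and all its steps stable with probability at least `q ^ 2 ^ j = 2 ^ (-o(log² N))`.

Along such a path the repaired independent sets `S t` move slowly. Let `U` be the union of the sets
recorded so far, and let the path run for a block of time longer than its mixing time. Either
`#(S t \ U)` passes through a prescribed window, and `S t` is recorded at that time; or, at the end
of the block, `U` contains a large independent set of a graph nearly independent of the earlier
ones. First-moment bounds for boundedly many such extensions, and for the second alternative, are
`2 ^ (-Ω(log² N))`, a contradiction. The extra randomness `ω` is fixed beforehand by averaging.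
-/

namespace DenseIndSet

open scoped Matrix

section Matrices

variable {X : Type*} [Fintype X] {M Q : Matrix X X ℝ}

lemma dotProduct_mul_self_mulVec (hQ : Q.IsSymm) (g : X → ℝ) :
    g ⬝ᵥ (Q * Q) *ᵥ g = ∑ x, (Q *ᵥ g) x ^ 2 := by
  rw [← Matrix.mulVec_mulVec, Matrix.dotProduct_mulVec, ← Matrix.mulVec_transpose, hQ.eq]
  simp only [dotProduct, sq]

lemma sq_sum_mulVec_le (hQ : Q.IsSymm) (g : X → ℝ) :
    (∑ x, (Q *ᵥ g) x) ^ 2 ≤ Fintype.card X * (g ⬝ᵥ (Q * Q) *ᵥ g) := by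
  rw [dotProduct_mul_self_mulVec hQ]
  exact sq_sum_le_card_mul_sum_sq

variable [DecidableEq X]

lemma sq_sum_le_card_mul_dotProduct (hQ : Q.IsSymm) (hQs : Q ∈ doublyStochastic ℝ X)
    (g : X → ℝ) : (∑ x, g x) ^ 2 ≤ Fintype.card X * (g ⬝ᵥ (Q * Q) *ᵥ g) := by
  rw [← sum_mulVec_of_mem_doublyStochastic hQs]
  exact sq_sum_mulVec_le hQ g

lemma sum_mul_sq_sub_of_mem_doublyStochastic (hM : M ∈ doublyStochastic ℝ X) (f : X → ℝ) :
    ∑ x, ∑ y, M x y * (f x - f y) ^ 2 = 2 * (f ⬝ᵥ f - f ⬝ᵥ M *ᵥ f) := by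
  have hrow : ∑ x, ∑ y, M x y * f x ^ 2 = f ⬝ᵥ f := by
    simp only [← Finset.sum_mul, sum_row_of_mem_doublyStochastic hM, one_mul, dotProduct, sq]
  have hcol : ∑ x, ∑ y, M x y * f y ^ 2 = f ⬝ᵥ f := by
    rw [Finset.sum_comm]
    simp only [← Finset.sum_mul, sum_col_of_mem_doublyStochastic hM, one_mul, dotProduct, sq]
  have hcross : ∑ x, ∑ y, M x y * (f x * f y) = f ⬝ᵥ M *ᵥ f := by
    simp only [dotProduct, Matrix.mulVec, Finset.mul_sum]
    exact Finset.sum_congr rfl fun x _ => Finset.sum_congr rfl fun y _ => by ring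
  calc ∑ x, ∑ y, M x y * (f x - f y) ^ 2
      = ∑ x, ∑ y, (M x y * f x ^ 2 + M x y * f y ^ 2 - 2 * (M x y * (f x * f y))) :=
        Finset.sum_congr rfl fun x _ => Finset.sum_congr rfl fun y _ => by ring
    _ = 2 * (f ⬝ᵥ f - f ⬝ᵥ M *ᵥ f) := by
        simp only [Finset.sum_add_distrib, Finset.sum_sub_distrib, ← Finset.mul_sum, hrow, hcol,
          hcross]
        ring

theorem pow_mean_le_mean_pow_two_pow (hM : M.IsSymm) (h0 : 0 ≤ ∑ x, ∑ y, M x y) (j : ℕ) :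
    ((∑ x, ∑ y, M x y) / Fintype.card X) ^ 2 ^ j ≤
      (∑ x, ∑ y, (M ^ 2 ^ j) x y) / Fintype.card X := by
  induction j with
  | zero => simp
  | succ j ih =>
    have hQ : (M ^ 2 ^ j).IsSymm := hM.pow _
    have hsum (P : Matrix X X ℝ) : ∑ x, (P *ᵥ 1) x = ∑ x, ∑ y, P x y := by
      simp only [Matrix.mulVec, dotProduct_one]
    have hdot (P : Matrix X X ℝ) : (1 : X → ℝ) ⬝ᵥ P *ᵥ 1 = ∑ x, ∑ y, P x y := by
      rw [one_dotProduct, hsum]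
    have hsq := sq_sum_mulVec_le hQ 1
    rw [hsum, hdot, ← pow_two, ← pow_mul, ← pow_succ] at hsq
    calc ((∑ x, ∑ y, M x y) / Fintype.card X) ^ 2 ^ (j + 1)
        = (((∑ x, ∑ y, M x y) / Fintype.card X) ^ 2 ^ j) ^ 2 := by rw [pow_succ, pow_mul]
      _ ≤ ((∑ x, ∑ y, (M ^ 2 ^ j) x y) / Fintype.card X) ^ 2 := by gcongr
      _ ≤ (Fintype.card X * ∑ x, ∑ y, (M ^ 2 ^ (j + 1)) x y) / Fintype.card X ^ 2 := by
          rw [div_pow]; gcongr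
      _ = (∑ x, ∑ y, (M ^ 2 ^ (j + 1)) x y) / Fintype.card X := by
          rcases eq_or_ne (Fintype.card X : ℝ) 0 with h | h
          · simp [h]
          · field_simp

end Matrices

section Paths

variable {X : Type*}

/-- The weight of the path `x` of length `K` under the transition matrix `M`: the product of the
entries of `M` along its steps. -/
def pathWeight (M : Matrix X X ℝ) {K : ℕ} (x : Fin (K + 1) → X) : ℝ :=
  ∏ k : Fin K, M (x k.castSucc) (x k.succ)

lemma pathWeight_nonneg {M : Matrix X X ℝ} (hM : ∀ a b, 0 ≤ M a b) {K : ℕ}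
    (x : Fin (K + 1) → X) : 0 ≤ pathWeight M x :=
  Finset.prod_nonneg fun _ _ => hM _ _

lemma pathWeight_snoc (M : Matrix X X ℝ) {K : ℕ} (x : Fin (K + 1) → X) (a : X) :
    pathWeight M (Fin.snoc x a : Fin (K + 2) → X) = pathWeight M x * M (x (Fin.last K)) a := by
  simp only [pathWeight, Fin.prod_univ_castSucc (n := K), Fin.succ_last, Fin.snoc_last,
    Fin.succ_castSucc, Fin.snoc_castSucc]

variable [Fintype X]

lemma sum_path_succ {K : ℕ} (f : (Fin (K + 2) → X) → ℝ) :
    ∑ x, f x = ∑ x : Fin (K + 1) → X, ∑ a, f (Fin.snoc x a) := by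
  rw [← (Fin.snocEquiv fun _ : Fin (K + 2) => X).sum_comp, Fintype.sum_prod_type,
    Finset.sum_comm]
  rfl

lemma sum_pathWeight_mul_snoc (M : Matrix X X ℝ) {K : ℕ} (f : (Fin (K + 1) → X) → ℝ)
    (g : X → ℝ) :
    ∑ x : Fin (K + 2) → X, pathWeight M x * (f (Fin.init x) * g (x (Fin.last (K + 1))))
      = ∑ x : Fin (K + 1) → X, pathWeight M x * (f x * (M *ᵥ g) (x (Fin.last K))) := by
  simp only [sum_path_succ (K := K), pathWeight_snoc, Fin.snoc_last, Fin.init_snoc, Matrix.mulVec,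
    dotProduct, Finset.mul_sum]
  exact Finset.sum_congr rfl fun x _ => Finset.sum_congr rfl fun a _ => by ring

variable [DecidableEq X]

lemma sum_pathWeight_mul_last (M : Matrix X X ℝ) (K : ℕ) (g : X → ℝ) :
    ∑ x : Fin (K + 1) → X, pathWeight M x * g (x (Fin.last K)) = ∑ a, (M ^ K *ᵥ g) a := by
  induction K generalizing g with
  | zero =>
    simpa [pathWeight] using (Equiv.funUnique (Fin 1) X).sum_comp g
  | succ K ih =>
    have h := sum_pathWeight_mul_snoc M (K := K) 1 g
    simp only [Pi.one_apply, one_mul] at h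
    rw [h, ih, Matrix.mulVec_mulVec, ← pow_succ]

lemma sum_pathWeight (M : Matrix X X ℝ) (K : ℕ) :
    ∑ x : Fin (K + 1) → X, pathWeight M x = ∑ a, ∑ b, (M ^ K) a b := by
  simpa [Matrix.mulVec, dotProduct] using sum_pathWeight_mul_last M K 1

theorem sum_pathWeight_mul_of_le {M : Matrix X X ℝ} (hM : M ∈ doublyStochastic ℝ X) {K : ℕ}
    {s t : Fin (K + 1)} (hst : s ≤ t) (f g : X → ℝ) :
    ∑ x : Fin (K + 1) → X, pathWeight M x * (f (x s) * g (x t))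
      = f ⬝ᵥ M ^ (t - s : ℕ) *ᵥ g := by
  induction K generalizing g with
  | zero =>
    obtain rfl : s = 0 := Fin.fin_one_eq_zero s
    obtain rfl : t = 0 := Fin.fin_one_eq_zero t
    simpa [pathWeight, dotProduct] using (Equiv.funUnique (Fin 1) X).sum_comp fun a => f a * g a
  | succ K ih =>
    induction t using Fin.lastCases with
    | cast t =>
      obtain ⟨s, rfl⟩ := Fin.exists_castSucc_eq.2 (hst.trans_lt (Fin.castSucc_lt_last t)).ne
      have h := sum_pathWeight_mul_snoc M (fun x => f (x s) * g (x t)) 1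
      simp only [mulVec_one_of_mem_doublyStochastic hM, Pi.one_apply, mul_one] at h
      exact h.trans (ih (Fin.castSucc_le_castSucc_iff.1 hst) g)
    | last =>
      induction s using Fin.lastCases with
      | cast s =>
        have h := sum_pathWeight_mul_snoc M (fun x => f (x s)) g
        rw [ih (Fin.le_last s), Matrix.mulVec_mulVec, ← pow_succ, Fin.val_last,
          ← Nat.sub_add_comm s.is_le] at h
        exact h
      | last =>
        have h := sum_pathWeight_mul_last M (K + 1) (f * g)
        rw [sum_mulVec_of_mem_doublyStochastic (pow_mem hM _)] at h
        simpa [dotProduct] using h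

end Paths

section ChainLaw

variable {X : Type*} [Fintype X] [MeasurableSpace X] {M : Matrix X X ℝ} {K : ℕ}

/-- The law of the first `K + 1` states of the Markov chain with transition matrix `M` started
from the uniform distribution. -/
noncomputable def chainLaw (M : Matrix X X ℝ) (K : ℕ) : Measure (Fin (K + 1) → X) :=
  ∑ x, ENNReal.ofReal (pathWeight M x / Fintype.card X) • Measure.dirac x

instance : IsFiniteMeasure (chainLaw M K) := by
  unfold chainLaw
  have (x : Fin (K + 1) → X) : IsFiniteMeasure
      (ENNReal.ofReal (pathWeight M x / Fintype.card X) • Measure.dirac x) :=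
    Measure.smul_finite _ ENNReal.ofReal_ne_top
  infer_instance

variable [MeasurableSingletonClass X]

lemma chainLaw_real (hM : ∀ a b, 0 ≤ M a b) (S : Set (Fin (K + 1) → X)) :
    (chainLaw M K).real S = (∑ x, pathWeight M x * S.indicator 1 x) / Fintype.card X := by
  have hw (x : Fin (K + 1) → X) : 0 ≤ pathWeight M x / Fintype.card X :=
    div_nonneg (pathWeight_nonneg hM x) (Nat.cast_nonneg _)
  simp only [Measure.real, chainLaw, Measure.finsetSum_apply, Measure.smul_apply, smul_eq_mul]
  rw [Finset.sum_div, ENNReal.toReal_sum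
    fun x _ => ENNReal.mul_ne_top ENNReal.ofReal_ne_top (measure_ne_top _ _)]
  refine Finset.sum_congr rfl fun x _ => ?_
  by_cases hx : x ∈ S <;>
    simp [S.toFinite.measurableSet, ENNReal.toReal_ofReal (hw x), hx]

lemma chainLaw_real_forall_step (hM : ∀ a b, 0 ≤ M a b) [DecidableEq X] (R : X → X → Prop)
    [∀ a b, Decidable (R a b)] :
    (chainLaw M K).real {x | ∀ k : Fin K, R (x k.castSucc) (x k.succ)}
      = (∑ a, ∑ b, ((Matrix.of fun a b => if R a b then M a b else 0) ^ K) a b)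
        / Fintype.card X := by
  rw [chainLaw_real hM, ← sum_pathWeight]
  congr 1
  refine Finset.sum_congr rfl fun x _ => ?_
  by_cases hx : ∀ k : Fin K, R (x k.castSucc) (x k.succ)
  · simp [pathWeight, hx]
  · obtain ⟨k, hk⟩ := not_forall.1 hx
    have : pathWeight (Matrix.of fun a b => if R a b then M a b else 0) x = 0 :=
      Finset.prod_eq_zero (Finset.mem_univ k) (by simp [hk])
    simp [hx, this]

variable [DecidableEq X]

lemma chainLaw_real_eq_eq (hM : M ∈ doublyStochastic ℝ X) {s t : Fin (K + 1)} (hst : s ≤ t)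
    (a b : X) :
    (chainLaw M K).real {x | x s = a ∧ x t = b} = (M ^ (t - s : ℕ)) a b / Fintype.card X := by
  have hind (x : Fin (K + 1) → X) :
      Set.indicator (M := ℝ) {x : Fin (K + 1) → X | x s = a ∧ x t = b} 1 x
        = (Pi.single a 1 : X → ℝ) (x s) * (Pi.single b 1 : X → ℝ) (x t) := by
    simp [Set.indicator_apply, Pi.single_apply, ← ite_and, and_comm]
  have h := sum_pathWeight_mul_of_le hM hst (Pi.single a 1) (Pi.single b 1)
  simp only [← hind] at h
  rw [chainLaw_real fun _ _ => nonneg_of_mem_doublyStochastic hM]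
  exact congrArg (· / _) (h.trans (by simp))

lemma chainLaw_real_eq (hM : M ∈ doublyStochastic ℝ X) (s : Fin (K + 1)) (a : X) :
    (chainLaw M K).real {x | x s = a} = 1 / Fintype.card X := by
  simpa using chainLaw_real_eq_eq hM (le_refl s) a a

lemma isProbabilityMeasure_chainLaw [Nonempty X] (hM : M ∈ doublyStochastic ℝ X) :
    IsProbabilityMeasure (chainLaw M K) := by
  have h := sum_pathWeight_mul_of_le hM (le_refl (0 : Fin (K + 1))) 1 1
  rw [isProbabilityMeasure_iff_real, chainLaw_real fun _ _ => nonneg_of_mem_doublyStochastic hM]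
  simp_all

end ChainLaw

section TensorPower

variable {d α : Type*} [Fintype d]

/-- The `d`-th tensor power of `M`: the transition matrix of a `d`-tuple of states that evolve
independently according to `M`. -/
def tensorPower (d : Type*) {α : Type*} [Fintype d] (M : Matrix α α ℝ) :
    Matrix (d → α) (d → α) ℝ :=
  fun x y => ∏ i, M (x i) (y i)

lemma isSymm_tensorPower {M : Matrix α α ℝ} (hM : M.IsSymm) : (tensorPower d M).IsSymm :=
  Matrix.IsSymm.ext fun x y => Finset.prod_congr rfl fun i _ => hM.apply (x i) (y i)

lemma pathWeight_tensorPower (M : Matrix α α ℝ) {K : ℕ} (x : Fin (K + 1) → d → α) :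
    pathWeight (tensorPower d M) x = ∏ e, pathWeight M fun k => x k e :=
  Finset.prod_comm

variable [Fintype α] [DecidableEq d]

lemma tensorPower_mul (M M' : Matrix α α ℝ) :
    tensorPower d M * tensorPower d M' = tensorPower d (M * M') := by
  ext x z
  simp only [Matrix.mul_apply, tensorPower, ← Finset.prod_mul_distrib]
  rw [Finset.prod_univ_sum, Fintype.piFinset_univ]

lemma tensorPower_mulVec_prod (M : Matrix α α ℝ) (f : d → α → ℝ) (x : d → α) :
    (tensorPower d M *ᵥ fun y => ∏ i, f i (y i)) x = ∏ i, (M *ᵥ f i) (x i) := by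
  simp only [Matrix.mulVec, dotProduct, tensorPower, ← Finset.prod_mul_distrib]
  rw [Finset.prod_univ_sum, Fintype.piFinset_univ]

lemma tensorPower_mem_doublyStochastic [DecidableEq α] {M : Matrix α α ℝ}
    (hM : M ∈ doublyStochastic ℝ α) :
    tensorPower d M ∈ doublyStochastic ℝ (d → α) := by
  refine mem_doublyStochastic_iff_sum.2 ⟨fun x y => Finset.prod_nonneg fun i _ =>
    nonneg_of_mem_doublyStochastic hM, fun x => ?_, fun y => ?_⟩
  · simp only [tensorPower, ← Fintype.piFinset_univ, ← Finset.prod_univ_sum,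
      sum_row_of_mem_doublyStochastic hM, Finset.prod_const_one]
  · simp only [tensorPower, ← Fintype.piFinset_univ,
      ← Finset.prod_univ_sum (t := fun _ => Finset.univ) (f := fun i a => M a (y i)),
      sum_col_of_mem_doublyStochastic hM, Finset.prod_const_one]

theorem chainLaw_tensorPower_real [MeasurableSpace α] [MeasurableSingletonClass α]
    {M : Matrix α α ℝ} (hM : ∀ a b, 0 ≤ M a b) {K : ℕ} (B : d → Set (Fin (K + 1) → α)) :
    (chainLaw (tensorPower d M) K).real {x | ∀ e, (fun k => x k e) ∈ B e}
      = ∏ e, (chainLaw M K).real (B e) := by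
  have hind (x : Fin (K + 1) → d → α) :
      Set.indicator (M := ℝ) {x : Fin (K + 1) → d → α | ∀ e, (fun k => x k e) ∈ B e} 1 x
        = ∏ e, (B e).indicator (M := ℝ) 1 fun k => x k e := by
    classical
    simp only [Set.indicator_apply, Set.mem_ofPred_eq, Pi.one_apply, Fintype.prod_boole]
  have hpow : ∀ x y : d → α, 0 ≤ tensorPower d M x y :=
    fun x y => Finset.prod_nonneg fun i _ => hM (x i) (y i)
  simp only [chainLaw_real hM, chainLaw_real hpow, hind, pathWeight_tensorPower,
    ← Finset.prod_mul_distrib, Finset.prod_div_distrib]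
  congr 1
  · rw [Finset.prod_univ_sum, Fintype.piFinset_univ]
    exact (Equiv.piComm fun _ _ => α).sum_comp fun z : d → Fin (K + 1) → α =>
      ∏ e, pathWeight M (z e) * (B e).indicator 1 (z e)
  · simp

end TensorPower

section Noise

/-- The sign `1` of `false` and `-1` of `true`. -/
def sgn (b : Bool) : ℝ := if b then -1 else 1

/-- The transition matrix of a uniform bit, with correlation `ρ` between consecutive values. -/
noncomputable def bitNoise (ρ : ℝ) : Matrix Bool Bool ℝ :=
  fun a b => (1 + ρ * sgn a * sgn b) / 2

lemma isSymm_bitNoise (ρ : ℝ) : (bitNoise ρ).IsSymm :=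
  Matrix.IsSymm.ext fun a b => by simp only [bitNoise]; ring

lemma bitNoise_mem_doublyStochastic {ρ : ℝ} (hρ : ρ ∈ unitInterval) :
    bitNoise ρ ∈ doublyStochastic ℝ Bool := by
  have hrow (a : Bool) : ∑ b, bitNoise ρ a b = 1 := by simp [bitNoise, sgn]; ring
  refine mem_doublyStochastic_iff_sum.2 ⟨fun a b => ?_, hrow, fun b => ?_⟩
  · cases a <;> cases b <;> simp [bitNoise, sgn] <;> linarith [hρ.1, hρ.2]
  · simpa only [(isSymm_bitNoise ρ).apply] using hrow b

lemma bitNoise_mul (ρ ρ' : ℝ) : bitNoise ρ * bitNoise ρ' = bitNoise (ρ * ρ') := by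
  ext a b
  cases a <;> cases b <;> simp [Matrix.mul_apply, bitNoise, sgn] <;> ring

lemma bitNoise_pow (ρ : ℝ) (k : ℕ) : bitNoise ρ ^ k = bitNoise (ρ ^ k) := by
  induction k with
  | zero => ext a b; cases a <;> cases b <;> norm_num [bitNoise, sgn]
  | succ k ih => rw [pow_succ, ih, bitNoise_mul, pow_succ]

lemma chainLaw_bitNoise_real_eq {ρ : ℝ} (hρ : ρ ∈ unitInterval) {K : ℕ} (s : Fin (K + 1))
    (a : Bool) : (chainLaw (bitNoise ρ) K).real {z | z s = a} = 1 / 2 := by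
  simpa using chainLaw_real_eq (bitNoise_mem_doublyStochastic hρ) s a

lemma chainLaw_bitNoise_real_false_false_le {ρ : ℝ} (hρ : ρ ∈ unitInterval) {K τ : ℕ}
    {s t : Fin (K + 1)} (hst : s + τ ≤ (t : ℕ)) :
    (chainLaw (bitNoise ρ) K).real {z | z s = false ∧ z t = false}
      ≤ 1 / 2 * ((1 + ρ ^ τ) / 2) := by
  rw [chainLaw_real_eq_eq (bitNoise_mem_doublyStochastic hρ) (Fin.le_def.2 (by omega)),
    bitNoise_pow]
  have hpow : ρ ^ (t - s : ℕ) ≤ ρ ^ τ := pow_le_pow_of_le_one hρ.1 hρ.2 (by omega)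
  simp only [bitNoise, sgn, Fintype.card_bool, Nat.cast_ofNat]
  norm_num
  linarith

lemma bitNoise_mulVec_sgn (ρ : ℝ) : bitNoise ρ *ᵥ sgn = ρ • sgn := by
  ext a
  simp [Matrix.mulVec, dotProduct, bitNoise, sgn]
  ring

lemma bitNoise_mulVec_one (ρ : ℝ) : bitNoise ρ *ᵥ 1 = 1 := by
  ext a
  simp [Matrix.mulVec, dotProduct, bitNoise, sgn]
  ring

variable {d : Type*} [Fintype d]

/-- The transition matrix on the cube that applies `bitNoise ρ` to all coordinates
independently. -/
noncomputable def noise (d : Type*) [Fintype d] (ρ : ℝ) : Matrix (d → Bool) (d → Bool) ℝ :=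
  tensorPower d (bitNoise ρ)

lemma isSymm_noise (ρ : ℝ) : (noise d ρ).IsSymm := isSymm_tensorPower (isSymm_bitNoise ρ)

variable [DecidableEq d]

lemma noise_mul (ρ ρ' : ℝ) : noise d ρ * noise d ρ' = noise d (ρ * ρ') := by
  simp only [noise, tensorPower_mul, bitNoise_mul]

lemma noise_mem_doublyStochastic {ρ : ℝ} (hρ : ρ ∈ unitInterval) :
    noise d ρ ∈ doublyStochastic ℝ (d → Bool) :=
  tensorPower_mem_doublyStochastic (bitNoise_mem_doublyStochastic hρ)

theorem sq_sum_le_dotProduct_noise {ρ : ℝ} (hρ : ρ ∈ unitInterval) (g : (d → Bool) → ℝ) :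
    (∑ x, g x) ^ 2 ≤ Fintype.card (d → Bool) * (g ⬝ᵥ noise d ρ *ᵥ g) := by
  have h := sq_sum_le_card_mul_dotProduct (isSymm_noise √ρ)
    (noise_mem_doublyStochastic ⟨Real.sqrt_nonneg ρ, Real.sqrt_le_one.2 hρ.2⟩) g
  rwa [noise_mul, Real.mul_self_sqrt hρ.1] at h

end Noise

section Absent

variable {d : Type*} {K : ℕ}

/-- Every coordinate `e ∈ R` vanishes at the time `tm e`; in a path of graphs, these edges are
missing at the prescribed times. -/
def Absent (R : Finset d) (tm : d → Fin (K + 1)) (x : Fin (K + 1) → d → Bool) : Prop :=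
  ∀ e ∈ R, x (tm e) e = false

variable [Fintype d] [DecidableEq d]

theorem chainLaw_absent_and_le {ρ : ℝ} (hρ : ρ ∈ unitInterval) (R W : Finset d)
    (tm : d → Fin (K + 1)) {t : Fin (K + 1)} {τ : ℕ} (ht : ∀ e ∈ R ∩ W, tm e + τ ≤ (t : ℕ)) :
    (chainLaw (noise d ρ) K).real {x | Absent R tm x ∧ ∀ e ∈ W, x t e = false}
      ≤ (1 / 2) ^ R.card * ((1 + ρ ^ τ) / 2) ^ W.card := by
  set β : ℝ := (1 + ρ ^ τ) / 2 with hβ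
  have hβ0 : 1 / 2 ≤ β := by have := pow_nonneg hρ.1 τ; linarith
  have hM := bitNoise_mem_doublyStochastic hρ
  have := isProbabilityMeasure_chainLaw (K := K) hM
  let B (e : d) : Set (Fin (K + 1) → Bool) :=
    {z | (e ∈ R → z (tm e) = false) ∧ (e ∈ W → z t = false)}
  have hB (e : d) : (chainLaw (bitNoise ρ) K).real (B e)
      ≤ (if e ∈ R then 1 / 2 else 1) * if e ∈ W then β else 1 := by
    by_cases hR : e ∈ R <;> by_cases hW : e ∈ W
    · simpa [B, hR, hW] using
        chainLaw_bitNoise_real_false_false_le hρ (ht e (Finset.mem_inter.2 ⟨hR, hW⟩))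
    · simpa [B, hR, hW] using (chainLaw_bitNoise_real_eq hρ (tm e) false).le
    · simpa [B, hR, hW] using (chainLaw_bitNoise_real_eq hρ t false).trans_le hβ0
    · simp [B, hR, hW]
  have hevent : {x : Fin (K + 1) → d → Bool | Absent R tm x ∧ ∀ e ∈ W, x t e = false}
      = {x | ∀ e, (fun k => x k e) ∈ B e} := by
    ext x
    exact forall_and.symm
  rw [hevent, noise, chainLaw_tensorPower_real fun _ _ => nonneg_of_mem_doublyStochastic hM]
  calc ∏ e, (chainLaw (bitNoise ρ) K).real (B e)
      ≤ ∏ e, (if e ∈ R then 1 / 2 else 1) * if e ∈ W then β else 1 :=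
        Finset.prod_le_prod (fun _ _ => measureReal_nonneg) fun e _ => hB e
    _ = (1 / 2) ^ R.card * β ^ W.card := by
        simp only [Finset.prod_mul_distrib, Finset.prod_ite_mem, Finset.univ_inter,
          Finset.prod_const]

end Absent

section Walsh

variable {d : Type*}

/-- The Walsh function of a set of coordinates: the characters of the cube, which diagonalise
`noise`. -/
def walsh (I : Finset d) (x : d → Bool) : ℝ := ∏ i ∈ I, sgn (x i)

lemma prod_mem_span_walsh (I : Finset d) (f : d → Bool → ℝ) :
    (fun y => ∏ i ∈ I, f i (y i)) ∈ Submodule.span ℝ (walsh '' {J | J ⊆ I}) := by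
  classical
  have hsplit (i : d) (b : Bool) :
      f i b = (f i false - f i true) / 2 * sgn b + (f i false + f i true) / 2 := by
    cases b <;> simp [sgn] <;> ring
  have hexpand : (fun y => ∏ i ∈ I, f i (y i)) = ∑ J ∈ I.powerset,
      ((∏ i ∈ J, (f i false - f i true) / 2) * ∏ i ∈ I \ J, (f i false + f i true) / 2) •
        walsh J := by
    funext y
    simp only [hsplit _ (y _), Finset.prod_add, Finset.prod_mul_distrib, Finset.sum_apply,
      Pi.smul_apply, smul_eq_mul, walsh]
    exact Finset.sum_congr rfl fun J _ => by ring
  rw [hexpand]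
  exact Submodule.sum_mem _ fun J hJ => Submodule.smul_mem _ _ <|
    Submodule.subset_span ⟨J, Finset.mem_powerset.1 hJ, rfl⟩

lemma degreeFunctions_le_span_walsh (D : ℕ) :
    degreeFunctions d Bool D ≤ Submodule.span ℝ (walsh '' {I | I.card ≤ D}) := by
  refine Submodule.span_le.2 ?_
  rintro _ ⟨I, f, hI, rfl⟩
  exact Submodule.span_mono (Set.image_mono fun J hJ => (Finset.card_le_card hJ).trans hI)
    (prod_mem_span_walsh I f)

variable [Fintype d] [DecidableEq d]

lemma walsh_eq_prod (I : Finset d) (x : d → Bool) :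
    walsh I x = ∏ i, (if i ∈ I then sgn else 1) (x i) := by
  simp [walsh, Finset.prod_ite_mem, ite_apply]

lemma noise_mulVec_walsh (ρ : ℝ) (I : Finset d) :
    noise d ρ *ᵥ walsh I = ρ ^ I.card • walsh I := by
  have hbit (i : d) : bitNoise ρ *ᵥ (if i ∈ I then sgn else 1)
      = (if i ∈ I then ρ else 1) • if i ∈ I then sgn else 1 := by
    split_ifs
    · exact bitNoise_mulVec_sgn ρ
    · rw [one_smul, bitNoise_mulVec_one]
  funext x
  rw [funext (walsh_eq_prod I), noise, tensorPower_mulVec_prod]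
  simp only [hbit, Pi.smul_apply, smul_eq_mul, Finset.prod_mul_distrib, Finset.prod_ite_mem,
    Finset.univ_inter, Finset.prod_const]

lemma walsh_dotProduct_walsh (I J : Finset d) :
    walsh I ⬝ᵥ walsh J = if I = J then (2 : ℝ) ^ Fintype.card d else 0 := by
  have hbit (i : d) : ∑ b, (if i ∈ I then sgn else 1) b * (if i ∈ J then sgn else 1) b
      = if i ∈ I ↔ i ∈ J then 2 else 0 := by
    by_cases hI : i ∈ I <;> by_cases hJ : i ∈ J <;> norm_num [hI, hJ, sgn]
  simp only [dotProduct, walsh_eq_prod, ← Finset.prod_mul_distrib]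
  rw [← Fintype.piFinset_univ, ← Finset.prod_univ_sum (t := fun _ => Finset.univ)
    (f := fun i b => (if i ∈ I then sgn else 1) b * (if i ∈ J then sgn else 1) b)]
  simp only [hbit, Finset.prod_ite_zero, Finset.mem_univ, true_imp_iff, ← Finset.ext_iff,
    Finset.prod_const, Finset.card_univ]

lemma sum_walsh_dotProduct_sum_walsh (s : Finset (Finset d)) (a b : Finset d → ℝ) :
    (∑ I ∈ s, a I • walsh I) ⬝ᵥ (∑ I ∈ s, b I • walsh I)
      = 2 ^ Fintype.card d * ∑ I ∈ s, a I * b I := by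
  simp only [sum_dotProduct, dotProduct_sum, smul_dotProduct, dotProduct_smul,
    walsh_dotProduct_walsh, smul_eq_mul, mul_ite, mul_zero, Finset.mul_sum]
  refine Finset.sum_congr rfl fun I hI => ?_
  rw [Finset.sum_ite_eq', if_pos hI]
  ring

theorem pow_mul_dotProduct_self_le {D : ℕ} {f : (d → Bool) → ℝ} (hf : f ∈ degreeFunctions d Bool D)
    {ρ : ℝ} (hρ : ρ ∈ unitInterval) : ρ ^ D * (f ⬝ᵥ f) ≤ f ⬝ᵥ noise d ρ *ᵥ f := by
  have hf' := degreeFunctions_le_span_walsh D hf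
  rw [← Finset.coe_filter_univ, Submodule.mem_span_image_finset_iff_exists_fun'] at hf'
  obtain ⟨a, rfl⟩ := hf'
  have hnoise : noise d ρ *ᵥ (∑ I with I.card ≤ D, a I • walsh I)
      = ∑ I with I.card ≤ D, (a I * ρ ^ I.card) • walsh I := by
    simp only [Matrix.mulVec_sum, Matrix.mulVec_smul, noise_mulVec_walsh, smul_smul]
  rw [hnoise, sum_walsh_dotProduct_sum_walsh, sum_walsh_dotProduct_sum_walsh, mul_left_comm,
    Finset.mul_sum]
  refine mul_le_mul_of_nonneg_left (Finset.sum_le_sum fun I hI => ?_) (by positivity)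
  have hpow : ρ ^ D ≤ ρ ^ I.card :=
    pow_le_pow_of_le_one hρ.1 hρ.2 (Finset.mem_filter.1 hI).2
  nlinarith [mul_le_mul_of_nonneg_right hpow (mul_self_nonneg (a I))]

theorem sum_noise_mul_sq_sub_le {D : ℕ} {f : (d → Bool) → ℝ} (hf : f ∈ degreeFunctions d Bool D)
    {ρ : ℝ} (hρ : ρ ∈ unitInterval) :
    ∑ x, ∑ y, noise d ρ x y * (f x - f y) ^ 2 ≤ 2 * (1 - ρ ^ D) * ∑ x, f x ^ 2 := by
  have hff : f ⬝ᵥ f = ∑ x, f x ^ 2 := by simp only [dotProduct, sq]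
  rw [sum_mul_sq_sub_of_mem_doublyStochastic (noise_mem_doublyStochastic hρ), ← hff]
  linarith [pow_mul_dotProduct_self_le hf hρ]

end Walsh

section StablePaths

theorem pow_le_chainLaw_real_forall_step {X : Type*} [Fintype X]
    [MeasurableSpace X] [MeasurableSingletonClass X] {M : Matrix X X ℝ} (hM : M.IsSymm)
    (hM0 : ∀ a b, 0 ≤ M a b) (R : X → X → Prop) [∀ a b, Decidable (R a b)]
    (hR : ∀ a b, R a b ↔ R b a) (j : ℕ) :
    ((∑ a, ∑ b, if R a b then M a b else 0) / Fintype.card X) ^ 2 ^ j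
      ≤ (chainLaw M (2 ^ j)).real {x | ∀ k : Fin (2 ^ j), R (x k.castSucc) (x k.succ)} := by
  classical
  have hsymm : (Matrix.of fun a b => if R a b then M a b else 0).IsSymm :=
    Matrix.IsSymm.ext fun a b => by simp only [Matrix.of_apply, hR b a, hM.apply]
  rw [chainLaw_real_forall_step hM0]
  refine pow_mean_le_mean_pow_two_pow hsymm (Finset.sum_nonneg fun a _ => Finset.sum_nonneg
    fun b _ => ?_) j
  simp only [Matrix.of_apply]
  split_ifs
  exacts [hM0 a b, le_rfl]

lemma forall_fin_of_forall_step {K : ℕ} (hK : K ≠ 0) {P : Fin (K + 1) → Prop}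
    (h : ∀ k : Fin K, P k.castSucc ∧ P k.succ) (t : Fin (K + 1)) : P t := by
  obtain ⟨K, rfl⟩ := Nat.exists_eq_succ_of_ne_zero hK
  induction t using Fin.cases with
  | zero => exact (h 0).1
  | succ k => exact (h k).2

variable {d κ : Type*} [Fintype d]

lemma sq_card_le_sum_noise {ρ : ℝ} (hρ : ρ ∈ unitInterval) (G : Finset (d → Bool)) :
    (G.card : ℝ) ^ 2 ≤ 2 ^ Fintype.card d * ∑ x ∈ G, ∑ y ∈ G, noise d ρ x y := by
  classical
  have h := sq_sum_le_dotProduct_noise hρ fun x => if x ∈ G then (1 : ℝ) else 0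
  simpa [dotProduct, Matrix.mulVec] using h

variable [DecidableEq d] [Fintype κ]

lemma sum_noise_mul_norm_sq_sub_le {D : ℕ} {A : (d → Bool) → EuclideanSpace ℝ κ}
    (hA : ∀ i, (fun y => A y i) ∈ degreeFunctions d Bool D) {ρ : ℝ} (hρ : ρ ∈ unitInterval) :
    ∑ x, ∑ y, noise d ρ x y * ‖A x - A y‖ ^ 2 ≤ 2 * (D * (1 - ρ)) * ∑ x, ‖A x‖ ^ 2 := by
  have hbernoulli : 1 - ρ ^ D ≤ D * (1 - ρ) := by
    have := one_add_mul_sub_le_pow (by linarith [hρ.1] : -1 ≤ ρ) D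
    linarith
  simp only [EuclideanSpace.real_norm_sq_eq, Finset.mul_sum, PiLp.sub_apply]
  calc ∑ x, ∑ y, ∑ i, noise d ρ x y * (A x i - A y i) ^ 2
      = ∑ i, ∑ x, ∑ y, noise d ρ x y * (A x i - A y i) ^ 2 :=
        (Finset.sum_congr rfl fun x _ => Finset.sum_comm).trans Finset.sum_comm
    _ ≤ ∑ i, 2 * (D * (1 - ρ)) * ∑ x, A x i ^ 2 := by
        refine Finset.sum_le_sum fun i _ => (sum_noise_mul_sq_sub_le (hA i) hρ).trans ?_
        gcongr
    _ = ∑ x, ∑ i, 2 * (D * (1 - ρ)) * A x i ^ 2 := by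
        simp only [Finset.mul_sum]
        rw [Finset.sum_comm]

open Classical in
lemma le_sum_noise_stable {D : ℕ} {A : (d → Bool) → EuclideanSpace ℝ κ}
    (hA : ∀ i, (fun y => A y i) ∈ degreeFunctions d Bool D) {ρ : ℝ} (hρ : ρ ∈ unitInterval)
    (G : Finset (d → Bool)) {v : ℝ} (hv : 0 < v) :
    (G.card : ℝ) ^ 2 / 2 ^ Fintype.card d - 2 * (D * (1 - ρ)) * (∑ x, ‖A x‖ ^ 2) / v
      ≤ ∑ x, ∑ y, if (x ∈ G ∧ y ∈ G) ∧ ‖A x - A y‖ ^ 2 ≤ v then noise d ρ x y else 0 := by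
  have hpoint (x y : d → Bool) : (if x ∈ G ∧ y ∈ G then noise d ρ x y else 0)
      - noise d ρ x y * ‖A x - A y‖ ^ 2 / v
        ≤ if (x ∈ G ∧ y ∈ G) ∧ ‖A x - A y‖ ^ 2 ≤ v then noise d ρ x y else 0 := by
    have hk : 0 ≤ noise d ρ x y := nonneg_of_mem_doublyStochastic (noise_mem_doublyStochastic hρ)
    have hd : 0 ≤ noise d ρ x y * ‖A x - A y‖ ^ 2 / v := by positivity
    by_cases hG : x ∈ G ∧ y ∈ G
    · by_cases hs : ‖A x - A y‖ ^ 2 ≤ v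
      · simpa [hG, hs] using hd
      · have := le_mul_of_one_le_right hk ((one_le_div hv).2 (not_le.1 hs).le)
        simpa [hG, hs, mul_div_assoc] using this
    · simpa [hG] using hd
  have hmarkov := div_le_div_of_nonneg_right (sum_noise_mul_norm_sq_sub_le hA hρ) hv.le
  have hmass : (G.card : ℝ) ^ 2 / 2 ^ Fintype.card d
      ≤ ∑ x, ∑ y, if x ∈ G ∧ y ∈ G then noise d ρ x y else 0 := by
    rw [div_le_iff₀' (by positivity)]
    simpa [ite_and] using sq_card_le_sum_noise hρ G
  refine (sub_le_sub hmass hmarkov).trans ?_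
  simp only [Finset.sum_div, ← Finset.sum_sub_distrib]
  exact Finset.sum_le_sum fun x _ => Finset.sum_le_sum fun y _ => hpoint x y

theorem pow_le_chainLaw_stable {D : ℕ} {A : (d → Bool) → EuclideanSpace ℝ κ}
    (hA : ∀ i, (fun y => A y i) ∈ degreeFunctions d Bool D) {ρ : ℝ} (hρ : ρ ∈ unitInterval)
    (G : Finset (d → Bool)) {v q : ℝ} (hv : 0 < v) (hq0 : 0 ≤ q)
    (hq : q ≤ ((G.card : ℝ) / 2 ^ Fintype.card d) ^ 2 -
      2 * (D * (1 - ρ)) * ((∑ x, ‖A x‖ ^ 2) / 2 ^ Fintype.card d) / v) (j : ℕ) :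
    q ^ 2 ^ j ≤ (chainLaw (noise d ρ) (2 ^ j)).real {x | (∀ t, x t ∈ G) ∧
      ∀ k : Fin (2 ^ j), ‖A (x k.castSucc) - A (x k.succ)‖ ^ 2 ≤ v} := by
  classical
  have hM0 (x y : d → Bool) : 0 ≤ noise d ρ x y :=
    nonneg_of_mem_doublyStochastic (noise_mem_doublyStochastic hρ)
  let R (x y : d → Bool) : Prop := (x ∈ G ∧ y ∈ G) ∧ ‖A x - A y‖ ^ 2 ≤ v
  have hR (x y : d → Bool) : R x y ↔ R y x := by
    simp only [R, norm_sub_rev (A x) (A y), and_comm (a := x ∈ G)]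
  have hq' : q ≤ (∑ x, ∑ y, if R x y then noise d ρ x y else 0) / Fintype.card (d → Bool) := by
    have h := le_sum_noise_stable hA hρ G hv
    have hcard : (Fintype.card (d → Bool) : ℝ) = 2 ^ Fintype.card d := by simp
    rw [hcard, le_div_iff₀ (by positivity)]
    refine (mul_le_mul_of_nonneg_right hq (by positivity)).trans (le_of_eq_of_le ?_ h)
    field_simp
  have hsteps : {x : Fin (2 ^ j + 1) → d → Bool | ∀ k : Fin (2 ^ j), R (x k.castSucc) (x k.succ)}
      ⊆ {x | (∀ t, x t ∈ G) ∧ ∀ k : Fin (2 ^ j), ‖A (x k.castSucc) - A (x k.succ)‖ ^ 2 ≤ v} :=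
    fun x hx => ⟨forall_fin_of_forall_step (by positivity) fun k => (hx k).1, fun k => (hx k).2⟩
  calc q ^ 2 ^ j
      ≤ ((∑ x, ∑ y, if R x y then noise d ρ x y else 0) / Fintype.card (d → Bool)) ^ 2 ^ j := by
        gcongr
    _ ≤ _ := pow_le_chainLaw_real_forall_step (isSymm_noise ρ) hM0 R hR j
    _ ≤ _ := measureReal_mono hsteps

end StablePaths

section Pairs

variable {N : ℕ}

/-- The pairs of distinct vertices of `S`, that is, the edges of the complete graph on `S`. -/
def pairsIn (S : Finset (Fin N)) : Finset (Pair N) :=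
  S.sym2.subtype fun e => ¬ e.IsDiag

lemma mem_pairsIn {S : Finset (Fin N)} {e : Pair N} : e ∈ pairsIn S ↔ ∀ v ∈ e.1, v ∈ S := by
  rw [pairsIn, Finset.mem_subtype, Finset.mem_sym2_iff]

lemma pairsIn_mono {S T : Finset (Fin N)} (h : S ⊆ T) : pairsIn S ⊆ pairsIn T :=
  fun _ he => mem_pairsIn.2 fun v hv => h (mem_pairsIn.1 he v hv)

lemma mk_mem_pairsIn {S : Finset (Fin N)} {u v : Fin N} (h : ¬ s(u, v).IsDiag) :
    (⟨s(u, v), h⟩ : Pair N) ∈ pairsIn S ↔ u ∈ S ∧ v ∈ S := by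
  simp [mem_pairsIn]

lemma card_pairsIn (S : Finset (Fin N)) : (pairsIn S).card = S.card.choose 2 := by
  rw [pairsIn, Finset.card_subtype, Finset.sym2_eq_image, Sym2.filter_image_mk_not_isDiag,
    Sym2.card_image_offDiag]

lemma graph_adj {y : Input N} {u v : Fin N} :
    (graph y).Adj u v ↔ ∃ h : ¬ s(u, v).IsDiag, y ⟨s(u, v), h⟩ = true := by
  simp only [graph, SimpleGraph.fromEdgeSet_adj, Set.mem_ofPred_eq, and_iff_left_iff_imp]
  rintro ⟨h, -⟩
  exact h

lemma isIndepSet_graph_iff {y : Input N} {S : Finset (Fin N)} :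
    (graph y).IsIndepSet (S : Set (Fin N)) ↔ ∀ e ∈ pairsIn S, y e = false := by
  constructor
  · rintro h ⟨e, he⟩ heS
    induction e using Sym2.ind with
    | _ u v =>
      obtain ⟨hu, hv⟩ := (mk_mem_pairsIn he).1 heS
      by_contra hy
      exact h hu hv he (graph_adj.2 ⟨he, by simpa using hy⟩)
  · intro h u hu v hv _ hadj
    obtain ⟨huv, hy⟩ := graph_adj.1 hadj
    simp [h _ ((mk_mem_pairsIn huv).2 ⟨hu, hv⟩)] at hy

lemma card_sdiff_mul_card_inter_le (U S : Finset (Fin N)) :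
    (S \ U).card * (S ∩ U).card ≤ (pairsIn S \ pairsIn U).card := by
  have hne (p : ↥((S \ U) ×ˢ (S ∩ U))) : ¬ s(p.1.1, p.1.2).IsDiag := by
    obtain ⟨⟨u, v⟩, hp⟩ := p
    simp only [Finset.mem_product, Finset.mem_sdiff, Finset.mem_inter] at hp
    rintro (rfl : u = v)
    exact hp.1.2 hp.2.2
  rw [← Finset.card_product, ← Finset.card_attach]
  refine Finset.card_le_card_of_injOn (fun p => ⟨s(p.1.1, p.1.2), hne p⟩) ?_ ?_
  · rintro ⟨⟨u, v⟩, hp⟩ -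
    simp only [Finset.mem_product, Finset.mem_sdiff, Finset.mem_inter] at hp
    simp [mk_mem_pairsIn, hp]
  · rintro ⟨⟨u, v⟩, hp⟩ - ⟨⟨u', v'⟩, hp'⟩ - h
    simp only [Finset.mem_product, Finset.mem_sdiff, Finset.mem_inter] at hp hp'
    rcases Sym2.eq_iff.1 (Subtype.mk.inj h) with ⟨rfl, rfl⟩ | ⟨rfl, rfl⟩
    · rfl
    · exact absurd hp'.2.2 hp.1.2

end Pairs

lemma sum_apply_card_le {α : Type*} [Fintype α] {F : ℕ → ℝ} {M : ℝ} (hF : ∀ n, 0 ≤ F n)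
    (hM : ∀ n, (Fintype.card α : ℝ) ^ n * F n ≤ M) :
    ∑ S : Finset α, F S.card ≤ (Fintype.card α + 1) * M := by
  rw [← Finset.powerset_univ, Finset.sum_powerset_apply_card, Finset.card_univ]
  calc ∑ n ∈ Finset.range (Fintype.card α + 1), (Fintype.card α).choose n • F n
      ≤ ∑ _n ∈ Finset.range (Fintype.card α + 1), M := by
        refine Finset.sum_le_sum fun n _ => le_trans ?_ (hM n)
        rw [nsmul_eq_mul]
        exact mul_le_mul_of_nonneg_right (mod_cast Nat.choose_le_pow _ n) (hF n)
    _ = (Fintype.card α + 1) * M := by simp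

section Extensions

variable {N : ℕ} {a h s₀ : ℝ} {U S : Finset (Fin N)}

/-- A set of at least `s₀` vertices, of which at least `a` and at most `h` lie outside `U`. -/
def IsExtension (a h s₀ : ℝ) (U S : Finset (Fin N)) : Prop :=
  a ≤ (S \ U).card ∧ ((S \ U).card : ℝ) ≤ h ∧ s₀ ≤ S.card

lemma IsExtension.card_union_le (hS : IsExtension a h s₀ U S) :
    ((U ∪ S).card : ℝ) ≤ U.card + h := by
  have hcard : ((U ∪ S).card : ℝ) = (S \ U).card + U.card := by
    rw [Finset.union_comm]
    exact_mod_cast (Finset.card_sdiff_add_card S U).symm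
  linarith [hS.2.1]

lemma IsExtension.half_pow_le (hS : IsExtension a h s₀ U S) {R : Finset (Pair N)}
    (hR : R ⊆ pairsIn U) :
    (1 / 2 : ℝ) ^ (pairsIn S \ R).card ≤ ((1 / 2) ^ (s₀ - h)) ^ (S \ U).card := by
  have hpairs : (S ∩ U).card * (S \ U).card ≤ (pairsIn S \ R).card := by
    rw [mul_comm]
    exact (card_sdiff_mul_card_inter_le U S).trans
      (Finset.card_le_card (Finset.sdiff_subset_sdiff subset_rfl hR))
  have hinter : s₀ - h ≤ (S ∩ U).card := by
    have : ((S \ U).card : ℝ) + (S ∩ U).card = S.card :=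
      mod_cast Finset.card_sdiff_add_card_inter S U
    linarith [hS.2.1, hS.2.2]
  calc (1 / 2 : ℝ) ^ (pairsIn S \ R).card
      ≤ ((1 / 2) ^ (S ∩ U).card) ^ (S \ U).card := by
        rw [← pow_mul]
        exact pow_le_pow_of_le_one (by norm_num) (by norm_num) hpairs
    _ ≤ ((1 / 2) ^ (s₀ - h)) ^ (S \ U).card := by
        rw [← Real.rpow_natCast (1 / 2) (S ∩ U).card]
        exact pow_le_pow_left₀ (by positivity)
          (Real.rpow_le_rpow_of_exponent_ge (by norm_num) (by norm_num) hinter) _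

lemma sum_apply_sdiff_le {F : Finset (Fin N) → ℝ} (hF : ∀ S, 0 ≤ F S)
    (s : Finset (Finset (Fin N))) (U : Finset (Fin N)) :
    ∑ S ∈ s, F (S \ U) ≤ 2 ^ U.card * ∑ S, F S := by
  have hinj : Set.InjOn (fun S : Finset (Fin N) => (S ∩ U, S \ U)) s := by
    intro S _ T _ hST
    simp only [Prod.mk.injEq] at hST
    rw [← Finset.sdiff_union_inter S U, hST.1, hST.2, Finset.sdiff_union_inter]
  calc ∑ S ∈ s, F (S \ U)
      = ∑ p ∈ s.image fun S => (S ∩ U, S \ U), F p.2 :=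
        (Finset.sum_image (f := fun p : Finset (Fin N) × Finset (Fin N) => F p.2) hinj).symm
    _ ≤ ∑ p ∈ U.powerset ×ˢ Finset.univ, F p.2 := by
        refine Finset.sum_le_sum_of_subset_of_nonneg ?_ fun p _ _ => hF p.2
        exact Finset.image_subset_iff.2 fun S _ => by simp
    _ = 2 ^ U.card * ∑ S, F S := by
        rw [Finset.sum_product]
        simp

theorem sum_half_pow_card_pairsIn_sdiff_le {q : ℝ} (hq0 : 0 < q) (hq1 : q ≤ 1)
    (hq : N * (1 / 2) ^ (s₀ - h) ≤ q) {s : Finset (Finset (Fin N))}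
    (hs : ∀ S ∈ s, IsExtension a h s₀ U S) {R : Finset (Pair N)} (hR : R ⊆ pairsIn U) :
    ∑ S ∈ s, (1 / 2 : ℝ) ^ (pairsIn S \ R).card ≤ 2 ^ U.card * ((N + 1) * q ^ a) := by
  set r : ℝ := (1 / 2) ^ (s₀ - h)
  let F (n : ℕ) : ℝ := if a ≤ n then r ^ n else 0
  have hF (n : ℕ) : 0 ≤ F n := by positivity
  have hcount (n : ℕ) : (N : ℝ) ^ n * F n ≤ q ^ a := by
    by_cases hn : a ≤ n
    · calc (N : ℝ) ^ n * F n = (N * r) ^ n := by rw [mul_pow]; simp only [F, hn, if_true]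
        _ ≤ q ^ n := pow_le_pow_left₀ (by positivity) hq n
        _ ≤ q ^ a := by
          rw [← Real.rpow_natCast]
          exact Real.rpow_le_rpow_of_exponent_ge hq0 hq1 hn
    · simp only [F, hn, if_false, mul_zero]
      positivity
  calc ∑ S ∈ s, (1 / 2 : ℝ) ^ (pairsIn S \ R).card
      ≤ ∑ S ∈ s, F (S \ U).card := Finset.sum_le_sum fun S hS => by
        simp only [F, (hs S hS).1, if_true]
        exact (hs S hS).half_pow_le hR
    _ ≤ 2 ^ U.card * ∑ S : Finset (Fin N), F S.card :=
        sum_apply_sdiff_le (F := fun S => F S.card) (fun S => hF S.card) s U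
    _ ≤ 2 ^ U.card * ((N + 1) * q ^ a) := by
        have := sum_apply_card_le (α := Fin N) hF (by simpa using hcount)
        rw [Fintype.card_fin] at this
        gcongr

end Extensions

section Chains

variable {N K : ℕ}

/-- Starting from a set `R` of pairs inside `U`, prescribed to be absent at the times `tm`, the path
of graphs `x` has `k` successive extensions of `U`, each independent at some time up to `T`, after
which the enlarged `U` satisfies `term`. -/
def ExtensionChain (a h s₀ : ℝ) (T : Fin (K + 1))
    (term : Finset (Fin N) → (Fin (K + 1) → Input N) → Prop) (x : Fin (K + 1) → Input N) :
    ℕ → Finset (Fin N) → Finset (Pair N) → (Pair N → Fin (K + 1)) → Prop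
  | 0, U, R, tm => Absent R tm x ∧ term U x
  | k + 1, U, R, tm => ∃ t ≤ T, ∃ S, IsExtension a h s₀ U S ∧
      ExtensionChain a h s₀ T term x k (U ∪ S) (R ∪ pairsIn S) (R.piecewise tm fun _ => t)

variable {a h s₀ : ℝ} {T : Fin (K + 1)}
  {term : Finset (Fin N) → (Fin (K + 1) → Input N) → Prop} {U : Finset (Fin N)}
  {R : Finset (Pair N)} {tm : Pair N → Fin (K + 1)}

lemma measureReal_extensionChain_succ_le (μ : Measure (Fin (K + 1) → Input N)) [IsFiniteMeasure μ]
    [DecidablePred (IsExtension a h s₀ U)] (k : ℕ) :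
    μ.real {x | ExtensionChain a h s₀ T term x (k + 1) U R tm}
      ≤ ∑ t ∈ Finset.Iic T, ∑ S with IsExtension a h s₀ U S,
          μ.real {x | ExtensionChain a h s₀ T term x k (U ∪ S) (R ∪ pairsIn S)
            (R.piecewise tm fun _ => t)} := by
  refine (measureReal_mono (fun x hx => ?_) (measure_ne_top _ _)).trans
    ((measureReal_biUnion_finset_le _ _).trans
      (Finset.sum_le_sum fun t _ => measureReal_biUnion_finset_le _ _))
  obtain ⟨t, ht, S, hS, hx⟩ := hx
  exact Set.mem_biUnion (Finset.mem_Iic.2 ht) (Set.mem_biUnion (by simpa using hS) hx)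

theorem chainLaw_extensionChain_le {ρ β γ B : ℝ} (hβ : 0 ≤ β) (hγ : 0 ≤ γ) (hh : 0 ≤ h)
    (hbase : ∀ U R tm, (U.card : ℝ) ≤ B → (∀ e ∈ R, tm e ≤ T) →
      (chainLaw (noise (Pair N) ρ) K).real {x | Absent R tm x ∧ term U x} ≤ γ * (1 / 2) ^ R.card)
    (hstep : ∀ (U : Finset (Fin N)) (R : Finset (Pair N)) (s : Finset (Finset (Fin N))),
      (U.card : ℝ) ≤ B → R ⊆ pairsIn U → (∀ S ∈ s, IsExtension a h s₀ U S) →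
      ∑ S ∈ s, (1 / 2 : ℝ) ^ (pairsIn S \ R).card ≤ β)
    (k : ℕ) (hU : U.card + k * h ≤ B) (hR : R ⊆ pairsIn U) (htm : ∀ e ∈ R, tm e ≤ T) :
    (chainLaw (noise (Pair N) ρ) K).real {x | ExtensionChain a h s₀ T term x k U R tm}
      ≤ ((K + 1) * β) ^ k * γ * (1 / 2) ^ R.card := by
  classical
  induction k generalizing U R tm with
  | zero => simpa [ExtensionChain] using hbase U R tm (by simpa using hU) htm
  | succ k ih =>
    set c : ℝ := ((K + 1) * β) ^ k * γ * (1 / 2) ^ R.card with hc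
    have hext (t : Fin (K + 1)) (ht : t ≤ T) (S : Finset (Fin N)) (hS : IsExtension a h s₀ U S) :
        (chainLaw (noise (Pair N) ρ) K).real {x | ExtensionChain a h s₀ T term x k (U ∪ S)
          (R ∪ pairsIn S) (R.piecewise tm fun _ => t)} ≤ c * (1 / 2) ^ (pairsIn S \ R).card := by
      refine (ih ?_ ?_ ?_).trans_eq ?_
      · push_cast at hU
        linarith [hS.card_union_le]
      · exact Finset.union_subset (hR.trans (pairsIn_mono Finset.subset_union_left))
          (pairsIn_mono Finset.subset_union_right)
      · intro e _
        by_cases he : e ∈ R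
        · simpa only [Finset.piecewise_eq_of_mem _ _ _ he] using htm e he
        · simpa only [Finset.piecewise_eq_of_notMem _ _ _ he] using ht
      · rw [hc, mul_assoc _ ((1 / 2 : ℝ) ^ R.card), ← pow_add, Finset.union_comm,
          ← Finset.card_sdiff_add_card, add_comm R.card]
    have hsum : ∑ S with IsExtension a h s₀ U S, (1 / 2 : ℝ) ^ (pairsIn S \ R).card ≤ β :=
      hstep U R _ ((le_add_of_nonneg_right (by positivity)).trans hU) hR
        fun S hS => (Finset.mem_filter.1 hS).2
    have hT : ((Finset.Iic T).card : ℝ) ≤ K + 1 :=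
      mod_cast (Finset.card_le_univ _).trans_eq (Fintype.card_fin _)
    calc (chainLaw (noise (Pair N) ρ) K).real {x | ExtensionChain a h s₀ T term x (k + 1) U R tm}
        ≤ ∑ t ∈ Finset.Iic T, ∑ S with IsExtension a h s₀ U S,
            c * (1 / 2) ^ (pairsIn S \ R).card :=
          (measureReal_extensionChain_succ_le _ k).trans <| Finset.sum_le_sum fun t ht =>
            Finset.sum_le_sum fun S hS =>
              hext t (Finset.mem_Iic.1 ht) S (Finset.mem_filter.1 hS).2
      _ = (Finset.Iic T).card *
            (c * ∑ S with IsExtension a h s₀ U S, (1 / 2) ^ (pairsIn S \ R).card) := by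
          simp only [Finset.sum_const, nsmul_eq_mul, Finset.mul_sum]
      _ ≤ (K + 1) * (c * β) := by gcongr
      _ = ((K + 1) * β) ^ (k + 1) * γ * (1 / 2) ^ R.card := by rw [hc]; ring

/-- Some subset of `U` of size at least `w` is independent at time `t`. -/
def IndepInside (w : ℝ) (t : Fin (K + 1)) (U : Finset (Fin N)) (x : Fin (K + 1) → Input N) :
    Prop :=
  ∃ W ⊆ U, w ≤ W.card ∧ (graph (x t)).IsIndepSet (W : Set (Fin N))

lemma Absent.union_piecewise {x : Fin (K + 1) → Input N} (hR : Absent R tm x)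
    {R' : Finset (Pair N)} {t : Fin (K + 1)} (hR' : ∀ e ∈ R', x t e = false) :
    Absent (R ∪ R') (R.piecewise tm fun _ => t) x := by
  intro e he
  by_cases heR : e ∈ R
  · rw [Finset.piecewise_eq_of_mem _ _ _ heR]
    exact hR e heR
  · rw [Finset.piecewise_eq_of_notMem _ _ _ heR]
    exact hR' e ((Finset.mem_union.1 he).resolve_left heR)

lemma exists_le_apply_le_add {f : Fin (K + 1) → ℝ} {a δ : ℝ}
    (hstep : ∀ k : Fin K, f k.succ ≤ f k.castSucc + δ) {s t : Fin (K + 1)} (hst : s ≤ t)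
    (hs : f s < a) (ht : a ≤ f t) : ∃ u ≤ t, a ≤ f u ∧ f u ≤ a + δ := by
  induction t using Fin.induction with
  | zero => exact absurd hs (by rwa [Fin.le_zero_iff.1 hst, not_lt])
  | succ k ih =>
    have hsk : s ≤ k.castSucc := by
      refine Fin.le_castSucc_iff.2 (hst.lt_of_ne ?_)
      rintro rfl
      exact hs.not_ge ht
    rcases le_or_gt a (f k.castSucc) with hk | hk
    · obtain ⟨u, hu, hau⟩ := ih hsk hk
      exact ⟨u, hu.trans (Fin.castSucc_lt_succ).le, hau⟩
    · exact ⟨k.succ, le_rfl, ht, by linarith [hstep k]⟩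

theorem extensionChain_or_indepInside {δ : ℝ} (ha : 0 < a) (hh : a + δ ≤ h)
    {x : Fin (K + 1) → Input N} {S : Fin (K + 1) → Finset (Fin N)}
    (hcard : ∀ t, s₀ ≤ (S t).card)
    (hindep : ∀ t, (graph (x t)).IsIndepSet (S t : Set (Fin N)))
    (hstep : ∀ k : Fin K, ((S k.succ \ S k.castSucc).card : ℝ) ≤ δ) (m : ℕ)
    {c : ℕ → Fin (K + 1)} (hc : Monotone c) {t₀ : Fin (K + 1)} (ht₀ : t₀ ≤ c 0)
    (hU : S t₀ ⊆ U) (hR : Absent R tm x) :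
    ExtensionChain a h s₀ (Fin.last K) (fun _ _ => True) x m U R tm ∨
      ∃ k < m, ExtensionChain a h s₀ (c k) (IndepInside (s₀ - a) (c (k + 1))) x k U R tm := by
  induction m generalizing c t₀ U R tm with
  | zero => exact Or.inl ⟨hR, trivial⟩
  | succ m ih =>
    rcases lt_or_ge ((S (c 1) \ U).card : ℝ) a with hstuck | hmoved
    · refine Or.inr ⟨0, m.succ_pos, hR, S (c 1) ∩ U, Finset.inter_subset_right, ?_, ?_⟩
      · have : ((S (c 1) \ U).card : ℝ) + (S (c 1) ∩ U).card = (S (c 1)).card :=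
          mod_cast Finset.card_sdiff_add_card_inter _ _
        linarith [hcard (c 1)]
      · exact (hindep (c 1)).mono (by simp)
    · have hstart : ((S t₀ \ U).card : ℝ) < a := by
        rwa [Finset.sdiff_eq_empty_iff_subset.2 hU, Finset.card_empty, Nat.cast_zero]
      have hslow (k : Fin K) : ((S k.succ \ U).card : ℝ) ≤ (S k.castSucc \ U).card + δ := by
        have : (S k.succ \ U).card ≤ (S k.succ \ S k.castSucc).card + (S k.castSucc \ U).card :=
          (Finset.card_le_card (sdiff_triangle _ _ _)).trans (Finset.card_union_le _ _)
        linarith [hstep k, (Nat.cast_le (α := ℝ)).2 this, Nat.cast_add (R := ℝ)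
          (S k.succ \ S k.castSucc).card (S k.castSucc \ U).card]
      -- The slowly growing count `#(S t \ U)` cannot jump over the window `[a, a + δ]`.
      obtain ⟨u, hu, hau, hua⟩ := exists_le_apply_le_add (f := fun t => ((S t \ U).card : ℝ))
        hslow (ht₀.trans (hc zero_le_one)) hstart hmoved
      have hext : IsExtension a h s₀ U (S u) := ⟨hau, hua.trans hh, hcard u⟩
      rcases ih (c := fun k => c (k + 1)) (fun i j hij => hc (by omega)) hu
        Finset.subset_union_right (hR.union_piecewise (isIndepSet_graph_iff.1 (hindep u)))
        with hfull | ⟨k, hk, hstuck⟩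
      · exact Or.inl ⟨u, Fin.le_last u, S u, hext, hfull⟩
      · exact Or.inr ⟨k + 1, by omega, u, hu.trans (hc (by omega)), S u, hext, hstuck⟩

end Chains

section FirstMoment

variable {N K : ℕ} {ι L ρ : ℝ}

lemma half_rpow (s : ℝ) : (1 / 2 : ℝ) ^ s = 2 ^ (-s) := by
  rw [one_div, Real.inv_rpow zero_le_two, Real.rpow_neg zero_le_two]

lemma half_pow_card_pairsIn (S : Finset (Fin N)) :
    (1 / 2 : ℝ) ^ (pairsIn S).card = 2 ^ (-(S.card * (S.card - 1) / 2 : ℝ)) := by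
  rw [card_pairsIn, ← Real.rpow_natCast, half_rpow, Nat.cast_choose_two]

lemma natCast_add_one_le_rpow (hL1 : 1 ≤ L) (hL : (N : ℝ) = 2 ^ L) : (N + 1 : ℝ) ≤ 2 ^ (2 * L) := by
  have h2L : 2 ≤ (2 : ℝ) ^ L := by
    simpa using Real.rpow_le_rpow_of_exponent_le one_le_two hL1
  rw [hL, two_mul, Real.rpow_add zero_lt_two]
  nlinarith

lemma sum_half_pow_card_pairsIn_sdiff_le_rpow (hι : 0 ≤ ι) (hL1 : 1 ≤ L) (hL : (N : ℝ) = 2 ^ L)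
    {B : ℝ} {U : Finset (Fin N)} (hU : U.card ≤ B) {s : Finset (Finset (Fin N))}
    (hs : ∀ S ∈ s, IsExtension (ι / 4 * L) (ι / 2 * L) ((1 + ι) * L) U S) {R : Finset (Pair N)}
    (hR : R ⊆ pairsIn U) :
    ∑ S ∈ s, (1 / 2 : ℝ) ^ (pairsIn S \ R).card ≤ 2 ^ (2 * L + B - ι ^ 2 / 8 * L ^ 2) := by
  have hιL : 0 ≤ ι * L := by positivity
  have hq : N * (1 / 2 : ℝ) ^ ((1 + ι) * L - ι / 2 * L) ≤ 2 ^ (-(ι / 2 * L)) := by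
    rw [hL, half_rpow, ← Real.rpow_add zero_lt_two]
    exact Real.rpow_le_rpow_of_exponent_le one_le_two (by linarith)
  calc ∑ S ∈ s, (1 / 2 : ℝ) ^ (pairsIn S \ R).card
      ≤ 2 ^ U.card * ((N + 1) * (2 ^ (-(ι / 2 * L))) ^ (ι / 4 * L)) :=
        sum_half_pow_card_pairsIn_sdiff_le (by positivity)
          (Real.rpow_le_one_of_one_le_of_nonpos one_le_two (by linarith)) hq hs hR
    _ ≤ 2 ^ B * (2 ^ (2 * L) * (2 ^ (-(ι / 2 * L))) ^ (ι / 4 * L)) := by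
        rw [← Real.rpow_natCast 2 U.card]
        gcongr
        exacts [one_le_two, natCast_add_one_le_rpow hL1 hL]
    _ = 2 ^ (2 * L + B - ι ^ 2 / 8 * L ^ 2) := by
        rw [← Real.rpow_mul zero_le_two, ← Real.rpow_add zero_lt_two,
          ← Real.rpow_add zero_lt_two]
        congr 1
        ring

/-- Some set of vertices is the start of a chain of `k` extensions on the scale `L = log₂ N`: sets
of at least `(1 + ι) L` vertices, each with between `(ι / 4) L` and `(ι / 2) L` new ones. The
starting set is independent at time `0`. -/
def HasExtensionChain (ι L : ℝ) (T : Fin (K + 1))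
    (term : Finset (Fin N) → (Fin (K + 1) → Input N) → Prop) (k : ℕ)
    (x : Fin (K + 1) → Input N) : Prop :=
  ∃ S, ExtensionChain (ι / 4 * L) (ι / 2 * L) ((1 + ι) * L) T term x k S (pairsIn S) fun _ => 0

variable {T : Fin (K + 1)} {term : Finset (Fin N) → (Fin (K + 1) → Input N) → Prop} {k : ℕ}

lemma chainLaw_extensionChain_le_rpow (hι : 0 ≤ ι) (hL1 : 1 ≤ L) (hL : (N : ℝ) = 2 ^ L)
    (hK : K + 1 ≤ N) {B γ : ℝ}
    (hbase : ∀ (U : Finset (Fin N)) R tm, (U.card : ℝ) ≤ B → (∀ e ∈ R, tm e ≤ T) →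
      (chainLaw (noise (Pair N) ρ) K).real {x | Absent R tm x ∧ term U x}
        ≤ 2 ^ γ * (1 / 2) ^ R.card)
    (S : Finset (Fin N)) (hS : S.card + k * (ι / 2 * L) ≤ B) :
    (chainLaw (noise (Pair N) ρ) K).real {x | ExtensionChain (ι / 4 * L) (ι / 2 * L) ((1 + ι) * L)
        T term x k S (pairsIn S) fun _ => 0}
      ≤ 2 ^ (k * (3 * L + B - ι ^ 2 / 8 * L ^ 2) + γ - S.card * (S.card - 1) / 2) := by
  have hK' : (K + 1 : ℝ) ≤ 2 ^ L := by rw [← hL]; exact_mod_cast hK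
  calc (chainLaw (noise (Pair N) ρ) K).real {x | ExtensionChain (ι / 4 * L) (ι / 2 * L)
          ((1 + ι) * L) T term x k S (pairsIn S) fun _ => 0}
      ≤ ((K + 1) * 2 ^ (2 * L + B - ι ^ 2 / 8 * L ^ 2)) ^ k * 2 ^ γ * (1 / 2) ^ (pairsIn S).card :=
        chainLaw_extensionChain_le (by positivity) (by positivity) (by positivity) hbase
          (fun U R s hU hR hs => sum_half_pow_card_pairsIn_sdiff_le_rpow hι hL1 hL hU hs hR) k hS
          subset_rfl fun _ _ => Fin.zero_le T
    _ ≤ (2 ^ L * 2 ^ (2 * L + B - ι ^ 2 / 8 * L ^ 2)) ^ k * 2 ^ γ *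
          2 ^ (-(S.card * (S.card - 1) / 2 : ℝ)) := by
        rw [half_pow_card_pairsIn]
        gcongr
    _ = 2 ^ (k * (3 * L + B - ι ^ 2 / 8 * L ^ 2) + γ - S.card * (S.card - 1) / 2) := by
        rw [← Real.rpow_add zero_lt_two, ← Real.rpow_natCast, ← Real.rpow_mul zero_le_two,
          ← Real.rpow_add zero_lt_two, ← Real.rpow_add zero_lt_two]
        congr 1
        ring

theorem chainLaw_hasExtensionChain_le (hι : 0 ≤ ι) (hL1 : 1 ≤ L) (hL : (N : ℝ) = 2 ^ L)
    (hK : K + 1 ≤ N) {Γ : ℝ → ℝ}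
    (hbase : ∀ (B : ℝ) (U : Finset (Fin N)) R tm, (U.card : ℝ) ≤ B → (∀ e ∈ R, tm e ≤ T) →
      (chainLaw (noise (Pair N) ρ) K).real {x | Absent R tm x ∧ term U x}
        ≤ 2 ^ Γ B * (1 / 2) ^ R.card)
    {E : ℝ} (hE : ∀ n : ℝ, 0 ≤ n → k * (3 * L + (n + k * (ι / 2 * L)) - ι ^ 2 / 8 * L ^ 2) +
      Γ (n + k * (ι / 2 * L)) - n * (n - 1) / 2 + L * n + 2 * L ≤ E) :
    (chainLaw (noise (Pair N) ρ) K).real {x | HasExtensionChain ι L T term k x} ≤ 2 ^ E := by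
  let B (n : ℝ) : ℝ := n + k * (ι / 2 * L)
  let F (n : ℕ) : ℝ :=
    2 ^ (k * (3 * L + B n - ι ^ 2 / 8 * L ^ 2) + Γ (B n) - (n : ℝ) * (n - 1) / 2)
  have hF (n : ℕ) : (N : ℝ) ^ n * F n ≤ 2 ^ (E - 2 * L) := by
    rw [hL, ← Real.rpow_natCast, ← Real.rpow_mul zero_le_two, ← Real.rpow_add zero_lt_two]
    refine Real.rpow_le_rpow_of_exponent_le one_le_two ?_
    simp only [B]
    linarith [hE n n.cast_nonneg]
  have hcover : {x : Fin (K + 1) → Input N | HasExtensionChain ι L T term k x}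
      = ⋃ S ∈ Finset.univ, {x | ExtensionChain (ι / 4 * L) (ι / 2 * L) ((1 + ι) * L) T term x k S
          (pairsIn S) fun _ => 0} := by
    ext x
    simp [HasExtensionChain]
  calc (chainLaw (noise (Pair N) ρ) K).real {x | HasExtensionChain ι L T term k x}
      ≤ ∑ S : Finset (Fin N), F S.card := by
        rw [hcover]
        exact (measureReal_biUnion_finset_le _ _).trans <| Finset.sum_le_sum fun S _ =>
          chainLaw_extensionChain_le_rpow hι hL1 hL hK (hbase _) S le_rfl
    _ ≤ (N + 1) * 2 ^ (E - 2 * L) := by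
        simpa using sum_apply_card_le (α := Fin N) (fun n => by positivity)
          (by simpa using hF)
    _ ≤ 2 ^ (2 * L) * 2 ^ (E - 2 * L) := by
        gcongr
        exact natCast_add_one_le_rpow hL1 hL
    _ = 2 ^ E := by
        rw [← Real.rpow_add zero_lt_two]
        congr 1
        ring

lemma chainLaw_absent_le (hρ : ρ ∈ unitInterval) (R : Finset (Pair N))
    (tm : Pair N → Fin (K + 1)) :
    (chainLaw (noise (Pair N) ρ) K).real {x | Absent R tm x} ≤ (1 / 2) ^ R.card := by
  simpa using chainLaw_absent_and_le hρ R ∅ tm (t := 0) (τ := 0) (by simp)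

theorem chainLaw_full_chain_le (hρ : ρ ∈ unitInterval) (hι : 0 ≤ ι) (hL1 : 1 ≤ L)
    (hL : (N : ℝ) = 2 ^ L) (hK : K + 1 ≤ N) {m : ℕ} (hm : 8 ≤ m * ι ^ 2) :
    (chainLaw (noise (Pair N) ρ) K).real
        {x | HasExtensionChain ι L (Fin.last K) (fun _ _ => True) m x}
      ≤ 2 ^ ((ι + 2) * (m + 2) ^ 2 * L - L ^ 2 / 2) := by
  refine chainLaw_hasExtensionChain_le hι hL1 hL hK (Γ := fun _ => 0) ?_ fun n _ => ?_
  · intro B U R tm _ _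
    simpa using chainLaw_absent_le hρ R tm
  · have hgain : L ^ 2 ≤ m * (ι ^ 2 / 8 * L ^ 2) := by nlinarith [sq_nonneg L]
    have hn := sq_nonneg (n - (L + m + 1 / 2))
    have hconst : (m + 1 / 2 : ℝ) ^ 2 ≤ (m + 1 / 2) ^ 2 * L :=
      le_mul_of_one_le_right (by positivity) hL1
    have : 0 ≤ m * L := by positivity
    have : 0 ≤ m ^ 2 * L := by positivity
    have : 0 ≤ ι * m ^ 2 * L := by positivity
    have : 0 ≤ ι * m * L := by positivity
    have : 0 ≤ ι * L := by positivity
    linarith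

lemma chainLaw_absent_and_isIndepSet_le (hρ : ρ ∈ unitInterval) {θ w : ℝ} (hw : 1 ≤ w)
    (hθ : 0 ≤ θ) {τ : ℕ} (hτ : (1 + ρ ^ τ) / 2 ≤ 2 ^ (-θ)) {R : Finset (Pair N)}
    {tm : Pair N → Fin (K + 1)} {t : Fin (K + 1)} (htm : ∀ e ∈ R, tm e + τ ≤ (t : ℕ))
    {W : Finset (Fin N)} (hW : w ≤ W.card) :
    (chainLaw (noise (Pair N) ρ) K).real
        {x | Absent R tm x ∧ (graph (x t)).IsIndepSet (W : Set (Fin N))}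
      ≤ (1 / 2) ^ R.card * 2 ^ (-(θ * (w * (w - 1) / 2))) := by
  have hW2 : w * (w - 1) ≤ W.card * (W.card - 1) := by nlinarith
  have hρτ : 0 ≤ ρ ^ τ := pow_nonneg hρ.1 τ
  simp only [isIndepSet_graph_iff]
  refine (chainLaw_absent_and_le hρ R (pairsIn W) tm
    fun e he => htm e (Finset.mem_inter.1 he).1).trans ?_
  gcongr
  calc ((1 + ρ ^ τ) / 2) ^ (pairsIn W).card ≤ (2 ^ (-θ)) ^ (pairsIn W).card := by gcongr
    _ = 2 ^ (-(θ * (W.card * (W.card - 1) / 2))) := by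
        rw [← Real.rpow_natCast, ← Real.rpow_mul zero_le_two, card_pairsIn, Nat.cast_choose_two,
          neg_mul]
    _ ≤ 2 ^ (-(θ * (w * (w - 1) / 2))) := by gcongr; exact one_le_two

theorem chainLaw_absent_and_indepInside_le (hρ : ρ ∈ unitInterval) {θ w B : ℝ} (hw : 1 ≤ w)
    (hθ : 0 ≤ θ) {τ : ℕ} (hτ : (1 + ρ ^ τ) / 2 ≤ 2 ^ (-θ)) {U : Finset (Fin N)}
    (hU : U.card ≤ B) {R : Finset (Pair N)} {tm : Pair N → Fin (K + 1)} {t : Fin (K + 1)}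
    (htm : ∀ e ∈ R, tm e + τ ≤ (t : ℕ)) :
    (chainLaw (noise (Pair N) ρ) K).real {x | Absent R tm x ∧ IndepInside w t U x}
      ≤ 2 ^ (B - θ * (w * (w - 1) / 2)) * (1 / 2) ^ R.card := by
  classical
  let large : Finset (Finset (Fin N)) := {W ∈ U.powerset | w ≤ W.card}
  have hlarge : (large.card : ℝ) ≤ 2 ^ B := by
    calc (large.card : ℝ) ≤ U.powerset.card := mod_cast Finset.card_filter_le _ _
      _ = 2 ^ (U.card : ℝ) := by rw [Finset.card_powerset, Real.rpow_natCast]; norm_cast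
      _ ≤ 2 ^ B := Real.rpow_le_rpow_of_exponent_le one_le_two hU
  have hcover : {x | Absent R tm x ∧ IndepInside w t U x}
      ⊆ ⋃ W ∈ large, {x | Absent R tm x ∧ (graph (x t)).IsIndepSet (W : Set (Fin N))} := by
    rintro x ⟨hR, W, hWU, hwW, hW⟩
    exact Set.mem_biUnion (x := W) (by simp [large, hWU, hwW]) ⟨hR, hW⟩
  calc (chainLaw (noise (Pair N) ρ) K).real {x | Absent R tm x ∧ IndepInside w t U x}
      ≤ ∑ W ∈ large, (1 / 2 : ℝ) ^ R.card * 2 ^ (-(θ * (w * (w - 1) / 2))) :=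
        (measureReal_mono hcover (measure_ne_top _ _)).trans <|
          (measureReal_biUnion_finset_le _ _).trans <| Finset.sum_le_sum fun W hW =>
            chainLaw_absent_and_isIndepSet_le hρ hw hθ hτ htm (Finset.mem_filter.1 hW).2
    _ ≤ 2 ^ B * ((1 / 2 : ℝ) ^ R.card * 2 ^ (-(θ * (w * (w - 1) / 2)))) := by
        rw [Finset.sum_const, nsmul_eq_mul]
        gcongr
    _ = 2 ^ (B - θ * (w * (w - 1) / 2)) * (1 / 2) ^ R.card := by
        rw [sub_eq_add_neg B, Real.rpow_add zero_lt_two]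
        ring

theorem chainLaw_stuck_chain_le (hρ : ρ ∈ unitInterval) (hι : 0 ≤ ι) (hL1 : 1 ≤ L)
    (hL : (N : ℝ) = 2 ^ L) (hK : K + 1 ≤ N) {m τ : ℕ} (hkm : k ≤ m)
    (hτ : (1 + ρ ^ τ) / 2 ≤ 2 ^ (-((1 + ι) / (1 + 3 / 4 * ι) ^ 2))) {t : Fin (K + 1)}
    (ht : T + τ ≤ (t : ℕ)) :
    (chainLaw (noise (Pair N) ρ) K).real
        {x | HasExtensionChain ι L T (IndepInside ((1 + ι) * L - ι / 4 * L) t) k x}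
      ≤ 2 ^ ((ι + 2) * (m + 2) ^ 2 * L - ι / 2 * L ^ 2) := by
  set θ := (1 + ι) / (1 + 3 / 4 * ι) ^ 2 with hθ
  set w := (1 + ι) * L - ι / 4 * L with hw
  have hθ0 : 0 ≤ θ := by positivity
  have hιL : 0 ≤ ι * L := by positivity
  have hw1 : 1 ≤ w := by linarith
  have hθw2 : θ * w ^ 2 = (1 + ι) * L ^ 2 := by
    rw [hθ, hw]
    field_simp
    ring
  have hθw : θ * w ≤ (1 + ι) * L := by
    have : L * (θ * w) ≤ L * ((1 + ι) * L) := by nlinarith [mul_nonneg hθ0 (zero_le_one.trans hw1)]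
    exact le_of_mul_le_mul_left this (by linarith)
  refine chainLaw_hasExtensionChain_le hι hL1 hL hK (Γ := fun B => B - θ * (w * (w - 1) / 2))
    (fun B U R tm hU htm => chainLaw_absent_and_indepInside_le hρ hw1 hθ0 hτ hU
      fun e he => (Nat.add_le_add_right (htm e he) τ).trans ht) fun n hn => ?_
  have hkm' : (k : ℝ) ≤ m := mod_cast hkm
  have hsteps : k * (3 * L + (n + k * (ι / 2 * L)) - ι ^ 2 / 8 * L ^ 2)
      ≤ m * (3 * L + (n + m * (ι / 2 * L))) := by
    refine (mul_le_mul_of_nonneg_left (sub_le_self _ (by positivity)) k.cast_nonneg).trans ?_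
    gcongr
  have hunion : k * (ι / 2 * L) ≤ m * (ι / 2 * L) := by gcongr
  have hsq := sq_nonneg (n - (L + m + 3 / 2))
  have hconst : (m + 3 / 2 : ℝ) ^ 2 ≤ (m + 3 / 2) ^ 2 * L :=
    le_mul_of_one_le_right (by positivity) hL1
  have : 0 ≤ m * L := by positivity
  have : 0 ≤ m ^ 2 * L := by positivity
  have : 0 ≤ m ^ 2 * (ι * L) := by positivity
  have : 0 ≤ m * (ι * L) := by positivity
  linarith

end FirstMoment

section UniformGraph

variable {N : ℕ}

instance (N : ℕ) : IsProbabilityMeasure (gnpHalf N) :=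
  inferInstanceAs (IsProbabilityMeasure (Measure.pi _))

lemma gnpHalf_real_singleton (y : Input N) :
    (gnpHalf N).real {y} = (2 ^ Fintype.card (Pair N))⁻¹ := by
  have hbit (b : Bool) : (bernoulliMeasure true false half).real {b} = 2⁻¹ := by
    rw [bernoulliMeasure_real_apply half (measurableSet_singleton b)]
    cases b <;> norm_num [half]
  simp only [Measure.real] at hbit
  simp only [gnpHalf, Measure.real, Measure.pi_singleton, ENNReal.toReal_prod, hbit,
    Finset.prod_const, Finset.card_univ, inv_pow]

lemma gnpHalf_real_coe (G : Finset (Input N)) :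
    (gnpHalf N).real (G : Set (Input N)) = G.card / 2 ^ Fintype.card (Pair N) := by
  rw [← sum_measureReal_singleton]
  simp only [gnpHalf_real_singleton, Finset.sum_const, nsmul_eq_mul, div_eq_mul_inv]

lemma integral_gnpHalf (f : Input N → ℝ) :
    ∫ y, f y ∂gnpHalf N = (∑ y, f y) / 2 ^ Fintype.card (Pair N) := by
  rw [integral_fintype .of_finite, div_eq_inv_mul, Finset.mul_sum]
  simp only [gnpHalf_real_singleton, smul_eq_mul]

end UniformGraph

section Rounding

variable {N : ℕ} {u v : EuclideanSpace ℝ (Fin N)} {S T : Finset (Fin N)}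

lemma roundEntry_eq_some_false_iff {z : ℝ} : roundEntry z = some false ↔ |z| ≤ 1 / 2 := by
  unfold roundEntry
  split_ifs with h₀ h₁ <;> simp only [h₀, Option.some.injEq, Bool.true_eq_false]

lemma roundEntry_eq_some_true_iff {z : ℝ} : roundEntry z = some true ↔ 1 ≤ |z| := by
  unfold roundEntry
  split_ifs with h₀ h₁
  · simpa using h₀.trans_lt one_half_lt_one
  all_goals simp [h₁]

lemma one_le_four_mul_sq_sub {a b : ℝ} (ha : roundEntry a = some false)
    (hb : roundEntry b = some true) : 1 ≤ 4 * (a - b) ^ 2 := by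
  rw [roundEntry_eq_some_false_iff] at ha
  rw [roundEntry_eq_some_true_iff] at hb
  have hdist : 1 / 2 ≤ |a - b| := by
    linarith [abs_sub_abs_le_abs_sub b a, abs_sub_comm a b]
  rw [← sq_abs]
  nlinarith

lemma card_rounding_flips_le (u v : EuclideanSpace ℝ (Fin N)) :
    (Finset.card {i | roundVec u i = some false ∧ roundVec v i = some true} : ℝ) ≤
      4 * ‖u - v‖ ^ 2 := by
  rw [Finset.cast_card, EuclideanSpace.real_norm_sq_eq, Finset.mul_sum]
  refine (Finset.sum_le_sum fun i hi => ?_).trans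
    (Finset.sum_le_univ_sum_of_nonneg fun i => by positivity)
  obtain ⟨hu, hv⟩ := (Finset.mem_filter.1 hi).2
  exact one_le_four_mul_sq_sub hu hv

lemma card_sdiff_le_hammingDist_add (u v : EuclideanSpace ℝ (Fin N)) (S T : Finset (Fin N)) :
    ((T \ S).card : ℝ) ≤ hammingDist (indicatorVec S) (roundVec u) +
      hammingDist (indicatorVec T) (roundVec v) + 4 * ‖u - v‖ ^ 2 := by
  classical
  have hsub : T \ S ⊆ (({i | indicatorVec S i ≠ roundVec u i} : Finset (Fin N)) ∪
      ({i | indicatorVec T i ≠ roundVec v i} : Finset (Fin N))) ∪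
      ({i | roundVec u i = some false ∧ roundVec v i = some true} : Finset (Fin N)) := by
    intro i hi
    obtain ⟨hT, hS⟩ := Finset.mem_sdiff.1 hi
    have hSi : indicatorVec S i = some false := by simp [indicatorVec, hS]
    have hTi : indicatorVec T i = some true := by simp [indicatorVec, hT]
    simp only [Finset.mem_union, Finset.mem_filter_univ, hSi, hTi, ne_comm (a := some _)]
    tauto
  have hcard := (Finset.card_le_card hsub).trans ((Finset.card_union_le _ _).trans
    (Nat.add_le_add_right (Finset.card_union_le _ _) _))
  have hcard' : ((T \ S).card : ℝ) ≤ hammingDist (indicatorVec S) (roundVec u) +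
      hammingDist (indicatorVec T) (roundVec v) +
      Finset.card {i | roundVec u i = some false ∧ roundVec v i = some true} := by
    exact_mod_cast hcard
  linarith [card_rounding_flips_le u v]

lemma IsRepairing.card_sdiff_le {b : ℝ}
    {F : (Fin N → Option Bool) → Input N → Option (Finset (Fin N))} (hF : IsRepairing b F)
    {y z : Input N} (hS : F (roundVec u) y = some S) (hT : F (roundVec v) z = some T) :
    ((T \ S).card : ℝ) ≤ 2 * (b * Real.logb 2 N) + 4 * ‖u - v‖ ^ 2 := by
  linarith [card_sdiff_le_hammingDist_add u v S T, (hF _ _ _ hS).2, (hF _ _ _ hT).2]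

end Rounding

section FixedSize

variable {N K : ℕ} {ι L : ℝ} {A : Input N → EuclideanSpace ℝ (Fin N)}
  {F : (Fin N → Option Bool) → Input N → Option (Finset (Fin N))}

lemma hasExtensionChain_of_stable (hι : 0 < ι) (hL0 : 0 < L) (hL : (N : ℝ) = 2 ^ L)
    (hF : IsRepairing (ι / 12) F) {x : Fin (K + 1) → Input N}
    (hx : ∀ t, IsLargeIndepSet ι (x t) (F (roundVec (A (x t))) (x t)))
    (hstable : ∀ k : Fin K, ‖A (x k.castSucc) - A (x k.succ)‖ ^ 2 ≤ ι / 48 * L) (m : ℕ)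
    {c : ℕ → Fin (K + 1)} (hc : Monotone c) :
    HasExtensionChain ι L (Fin.last K) (fun _ _ => True) m x ∨
      ∃ k < m, HasExtensionChain ι L (c k)
        (IndepInside ((1 + ι) * L - ι / 4 * L) (c (k + 1))) k x := by
  have hlog : Real.logb 2 N = L := by rw [hL, Real.logb_rpow zero_lt_two (by norm_num)]
  choose S hout hindep hcard using hx
  rw [hlog] at hcard
  have hstep (k : Fin K) : ((S k.succ \ S k.castSucc).card : ℝ) ≤ ι / 4 * L := by
    have := hF.card_sdiff_le (hout k.castSucc) (hout k.succ)
    rw [hlog] at this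
    linarith [hstable k]
  have hinit : Absent (pairsIn (S 0)) (fun _ => 0) x :=
    isIndepSet_graph_iff.1 (hindep 0)
  exact (extensionChain_or_indepInside (by positivity) (by linarith) hcard hindep hstep m hc
    (Fin.zero_le _) subset_rfl hinit).imp (fun h => ⟨_, h⟩) fun ⟨k, hk, h⟩ => ⟨k, hk, _, h⟩

lemma measureReal_or_exists_lt_le {α : Type*} [MeasurableSpace α] {μ : Measure α}
    [IsFiniteMeasure μ] {p : α → Prop} {r : ℕ → α → Prop} {m : ℕ} {C : ℝ}
    (hp : μ.real {x | p x} ≤ C) (hr : ∀ k < m, μ.real {x | r k x} ≤ C) :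
    μ.real {x | p x ∨ ∃ k < m, r k x} ≤ (m + 1) * C := by
  have hsub : {x | p x ∨ ∃ k < m, r k x} ⊆ {x | p x} ∪ ⋃ k ∈ Finset.range m, {x | r k x} :=
    fun x hx => by simpa using hx
  refine (measureReal_mono hsub (measure_ne_top _ _)).trans ((measureReal_union_le _ _).trans ?_)
  rw [add_comm (m : ℝ), add_mul, one_mul]
  refine add_le_add hp ((measureReal_biUnion_finset_le _ _).trans ?_)
  simpa using Finset.sum_le_card_nsmul _ _ _ fun k hk => hr k (Finset.mem_range.1 hk)

lemma measureReal_hasExtensionChain_le {ρ : ℝ} (hρ : ρ ∈ unitInterval) (hι : 0 ≤ ι) (hL1 : 1 ≤ L)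
    (hL : (N : ℝ) = 2 ^ L) (hK : K + 1 ≤ N) {m τ : ℕ} (hm : 8 ≤ m * ι ^ 2)
    (hτ : (1 + ρ ^ τ) / 2 ≤ 2 ^ (-((1 + ι) / (1 + 3 / 4 * ι) ^ 2))) {c : ℕ → Fin (K + 1)}
    (hc : ∀ k < m, c k + τ ≤ (c (k + 1) : ℕ)) :
    (chainLaw (noise (Pair N) ρ) K).real
      {x | HasExtensionChain ι L (Fin.last K) (fun _ _ => True) m x ∨
        ∃ k < m, HasExtensionChain ι L (c k)
          (IndepInside ((1 + ι) * L - ι / 4 * L) (c (k + 1))) k x} ≤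
      (m + 1) * 2 ^ ((ι + 2) * (m + 2) ^ 2 * L - min 1 ι / 2 * L ^ 2) := by
  have hexp {g : ℝ} (hg : min 1 ι / 2 * L ^ 2 ≤ g) :
      (2 : ℝ) ^ ((ι + 2) * (m + 2) ^ 2 * L - g) ≤
        2 ^ ((ι + 2) * (m + 2) ^ 2 * L - min 1 ι / 2 * L ^ 2) :=
    Real.rpow_le_rpow_of_exponent_le one_le_two (by linarith)
  have hfull := (chainLaw_full_chain_le hρ hι hL1 hL hK hm).trans
    (hexp (by linarith [mul_le_mul_of_nonneg_right (min_le_left 1 ι) (sq_nonneg L)]))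
  exact measureReal_or_exists_lt_le hfull fun k hk =>
    (chainLaw_stuck_chain_le hρ hι hL1 hL hK hk.le hτ (hc k hk)).trans
      (hexp (by linarith [mul_le_mul_of_nonneg_right (min_le_right 1 ι) (sq_nonneg L)]))

theorem pow_le_of_success {D : ℕ} (hA : ∀ i, (fun y => A y i) ∈ degreeFunctions (Pair N) Bool D)
    (hι : 0 < ι) (hF : IsRepairing (ι / 12) F) (hL1 : 1 ≤ L) (hL : (N : ℝ) = 2 ^ L) {ρ : ℝ}
    (hρ : ρ ∈ unitInterval) {m τ j : ℕ} (hm : 8 ≤ m * ι ^ 2)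
    (hτ : (1 + ρ ^ τ) / 2 ≤ 2 ^ (-((1 + ι) / (1 + 3 / 4 * ι) ^ 2))) (hj : m * τ ≤ 2 ^ j)
    (hK : 2 ^ j + 1 ≤ N) {q : ℝ} (hq0 : 0 ≤ q)
    (hq : q ≤ (gnpHalf N).real {y | IsLargeIndepSet ι y (F (roundVec (A y)) y)} ^ 2 -
      2 * (D * (1 - ρ)) * (∫ y, ‖A y‖ ^ 2 ∂gnpHalf N) / (ι / 48 * L)) :
    q ^ 2 ^ j ≤ (m + 1) * 2 ^ ((ι + 2) * (m + 2) ^ 2 * L - min 1 ι / 2 * L ^ 2) := by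
  classical
  set G : Finset (Input N) := {y | IsLargeIndepSet ι y (F (roundVec (A y)) y)} with hG
  let c (k : ℕ) : Fin (2 ^ j + 1) := ⟨min (k * τ) (2 ^ j), by omega⟩
  have hc_mono : Monotone c := fun k l hkl => by
    simp only [c, Fin.mk_le_mk]
    gcongr
  have hc_step (k : ℕ) (hk : k < m) : c k + τ ≤ (c (k + 1) : ℕ) := by
    have hle : (k + 1) * τ ≤ 2 ^ j := (Nat.mul_le_mul_right τ hk).trans hj
    simp only [c, min_eq_left hle]
    rw [Nat.succ_mul]
    omega
  have hGset : {y | IsLargeIndepSet ι y (F (roundVec (A y)) y)} = (G : Set (Input N)) := by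
    simp [hG]
  rw [hGset, gnpHalf_real_coe, integral_gnpHalf] at hq
  refine (pow_le_chainLaw_stable hA hρ G (by positivity) hq0 hq j).trans ?_
  refine le_trans (measureReal_mono (fun x hx => ?_)
    (measure_ne_top _ _)) (measureReal_hasExtensionChain_le hρ hι.le hL1 hL hK hm hτ hc_step)
  exact hasExtensionChain_of_stable hι (by positivity) hL hF
    (fun t => by simpa [hG] using hx.1 t) hx.2 m hc_mono

end FixedSize

section Asymptotics

lemma tendsto_logb_natCast : Tendsto (fun N : ℕ => Real.logb 2 N) atTop atTop :=
  (Real.tendsto_logb_atTop one_lt_two).comp tendsto_natCast_atTop_atTop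

lemma log_natCast_le_logb_two (N : ℕ) : Real.log N ≤ Real.logb 2 N :=
  le_div_self (Real.log_natCast_nonneg N) (Real.log_pos one_lt_two)
    (by linarith [Real.log_two_lt_d9])

lemma isLittleO_add_one_logb_sq {f : ℕ → ℝ}
    (hf : f =o[atTop] fun N : ℕ => Real.log N ^ 2) :
    (fun N => f N + 1) =o[atTop] fun N : ℕ => Real.logb 2 N ^ 2 := by
  have hlog : (fun N : ℕ => Real.log N ^ 2) =O[atTop] fun N : ℕ => Real.logb 2 N ^ 2 :=
    .of_bound' <| .of_forall fun N => by
      have := log_natCast_le_logb_two N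
      have := Real.log_natCast_nonneg N
      rw [norm_pow, norm_pow, Real.norm_of_nonneg this, Real.norm_of_nonneg (by linarith)]
      gcongr
  refine (hf.trans_isBigO hlog).add ?_
  exact isLittleO_const_left.2 <| .inr <| tendsto_norm_atTop_atTop.comp <|
    (tendsto_pow_atTop two_ne_zero).comp tendsto_logb_natCast

lemma isLittleO_logb_sq_natCast :
    (fun N : ℕ => Real.logb 2 N ^ 2) =o[atTop] fun N : ℕ => (N : ℝ) :=
  (Real.isLittleO_pow_logb_id_atTop (n := 2)).comp_tendsto tendsto_natCast_atTop_atTop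

lemma eventually_mul_rpow_lt_rpow {α : Type*} {l : Filter α} {L f : α → ℝ} (hL : Tendsto L l atTop)
    (hf : f =o[l] fun x => L x ^ 2) {c M q : ℝ} (a : ℝ) (hc : 0 < c) (hM : 0 < M) (hq : 0 < q) :
    ∀ᶠ x in l, M * 2 ^ (a * L x - c * L x ^ 2) < q ^ f x := by
  have hsq : Tendsto (fun x => ‖L x ^ 2‖) l atTop :=
    tendsto_norm_atTop_atTop.comp ((tendsto_pow_atTop two_ne_zero).comp hL)
  have hlin : L =o[l] fun x => L x ^ 2 := by
    simpa only [pow_one, Function.comp_def] using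
      (isLittleO_pow_pow_atTop_of_lt (𝕜 := ℝ) one_lt_two).comp_tendsto hL
  have hlower : (fun x => Real.logb 2 M + a * L x - Real.logb 2 q * f x) =o[l]
      fun x => L x ^ 2 :=
    ((isLittleO_const_left.2 (.inr hsq)).add (hlin.const_mul_left a)).sub (hf.const_mul_left _)
  filter_upwards [hlower.def (half_pos hc), hL.eventually_gt_atTop 0] with x hx hL0
  have hbound := (le_abs_self _).trans hx
  rw [Real.norm_of_nonneg (sq_nonneg _)] at hbound
  have hpos : 0 < c / 2 * L x ^ 2 := by positivity
  calc M * 2 ^ (a * L x - c * L x ^ 2)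
      = 2 ^ (Real.logb 2 M + (a * L x - c * L x ^ 2)) := by
        rw [Real.rpow_add zero_lt_two, Real.rpow_logb zero_lt_two (by norm_num) hM]
    _ < 2 ^ (Real.logb 2 q * f x) :=
        Real.rpow_lt_rpow_of_exponent_lt one_lt_two (by linarith)
    _ = q ^ f x := by
        rw [Real.rpow_mul zero_le_two, Real.rpow_logb zero_lt_two (by norm_num) hq]

lemma exists_noise_parameters {κ c : ℝ} (hκ : 0 < κ) (hc : 0 < c) (m : ℕ) :
    ∃ r : ℝ, ∀ D : ℕ, ∃ ρ ∈ unitInterval, ∃ τ j : ℕ,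
      D * (1 - ρ) ≤ c ∧ ρ ^ τ ≤ κ ∧ m * τ ≤ 2 ^ j ∧ (2 ^ j : ℝ) ≤ r * (D + 1) := by
  set ε := min 1 c
  have hε0 : 0 < ε := lt_min one_pos hc
  set T := ⌈-Real.log κ / ε⌉₊
  have hT : -Real.log κ ≤ T * ε := (div_le_iff₀ hε0).1 (Nat.le_ceil _)
  refine ⟨2 * (m * T + 1), fun D => ?_⟩
  have : (0 : ℝ) ≤ D := D.cast_nonneg
  have hρ0 : 0 ≤ 1 - ε / (D + 1) := by
    rw [sub_nonneg, div_le_one (by positivity)]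
    linarith [min_le_left 1 c]
  obtain ⟨n, hn, hn'⟩ := exists_nat_pow_near (x := m * (T * (D + 1)) + 1) (y := 2)
    (Nat.le_add_left _ _) one_lt_two
  refine ⟨1 - ε / (D + 1), ⟨hρ0, sub_le_self _ (by positivity)⟩, T * (D + 1), n + 1, ?_, ?_,
    by omega, ?_⟩
  · rw [sub_sub_cancel, ← mul_div_assoc, div_le_iff₀ (by positivity)]
    nlinarith [min_le_right 1 c]
  · calc (1 - ε / (D + 1)) ^ (T * (D + 1))
        ≤ Real.exp (-(ε / (D + 1))) ^ (T * (D + 1)) := by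
          gcongr
          exact Real.one_sub_le_exp_neg _
      _ = Real.exp (-(T * ε)) := by
          rw [← Real.exp_nat_mul]
          congr 1
          push_cast
          field_simp
      _ ≤ κ := by
          rw [← Real.le_log_iff_exp_le hκ]
          linarith
  · have hn_real : (2 : ℝ) ^ n ≤ m * (T * (D + 1)) + 1 := by exact_mod_cast hn
    rw [pow_succ]
    nlinarith

lemma half_lt_rpow_neg_deficit {ι : ℝ} (hι : 0 < ι) :
    1 / 2 < (2 : ℝ) ^ (-((1 + ι) / (1 + 3 / 4 * ι) ^ 2)) := by
  have hlt : (1 + ι) / (1 + 3 / 4 * ι) ^ 2 < 1 := by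
    rw [div_lt_one (by positivity)]
    nlinarith
  rw [one_div, ← Real.rpow_neg_one]
  exact Real.rpow_lt_rpow_of_exponent_lt one_lt_two (by linarith)

theorem eventually_success_lt {ι : ℝ} (hι : 0 < ι) {D : ℕ → ℕ}
    (hD : (fun N : ℕ => (D N : ℝ)) =o[atTop] (fun N : ℕ => Real.log N ^ 2)) {p C : ℝ}
    (hp : 0 < p) (hC : 0 < C) :
    ∀ᶠ N : ℕ in atTop, ∀ (A : Input N → EuclideanSpace ℝ (Fin N))
      (F : (Fin N → Option Bool) → Input N → Option (Finset (Fin N))),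
      (∀ i, (fun y => A y i) ∈ degreeFunctions (Pair N) Bool (D N)) →
      IsRepairing (ι / 12) F → ∫ y, ‖A y‖ ^ 2 ∂gnpHalf N ≤ C * Real.log N →
      (gnpHalf N).real {y | IsLargeIndepSet ι y (F (roundVec (A y)) y)} < p := by
  obtain ⟨m, hm⟩ := exists_nat_gt (8 / ι ^ 2)
  have hm8 : 8 ≤ m * ι ^ 2 := ((div_lt_iff₀ (by positivity)).1 hm).le
  obtain ⟨r, hr⟩ := exists_noise_parameters
    (sub_pos.2 (div_lt_iff₀' zero_lt_two |>.1 (half_lt_rpow_neg_deficit hι)))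
    (show 0 < ι * p ^ 2 / (192 * C) by positivity) m
  have hsteps : (fun N => r * (D N + 1)) =o[atTop] fun N : ℕ => Real.logb 2 N ^ 2 :=
    (isLittleO_add_one_logb_sq hD).const_mul_left r
  have hsize := (hsteps.trans isLittleO_logb_sq_natCast).def one_half_pos
  filter_upwards [eventually_mul_rpow_lt_rpow tendsto_logb_natCast hsteps ((ι + 2) * (m + 2) ^ 2)
      (show 0 < min 1 ι / 2 by positivity) (show 0 < (m + 1 : ℝ) by positivity)
      (show 0 < p ^ 2 / 2 by positivity),
    hsize, tendsto_logb_natCast.eventually_ge_atTop 1, eventually_ge_atTop 2]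
    with N hfirst hsize hL1 hN2 A F hA hF hnorm
  by_contra! hsuccess
  have hp1 : p ≤ 1 := hsuccess.trans measureReal_le_one
  obtain ⟨ρ, hρ, τ, j, hDρ, hτ, hj, hjr⟩ := hr (D N)
  have hL : (N : ℝ) = 2 ^ Real.logb 2 N :=
    (Real.rpow_logb zero_lt_two (by norm_num) (by positivity)).symm
  have hN2' : (2 : ℝ) ≤ N := by exact_mod_cast hN2
  have hK : 2 ^ j + 1 ≤ N := by
    have h := (le_abs_self _).trans hsize
    rw [RCLike.norm_natCast] at h
    have : (2 ^ j + 1 : ℝ) ≤ N := by linarith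
    exact_mod_cast this
  have hloss : 2 * (D N * (1 - ρ)) * (∫ y, ‖A y‖ ^ 2 ∂gnpHalf N) / (ι / 48 * Real.logb 2 N) ≤
      p ^ 2 / 2 := by
    rw [div_le_iff₀ (by positivity)]
    calc _ ≤ 2 * (ι * p ^ 2 / (192 * C)) * (C * Real.logb 2 N) := by
          gcongr
          exact hnorm.trans (by gcongr; exact log_natCast_le_logb_two N)
      _ = _ := by field_simp; norm_num
  have hpow := pow_le_of_success (q := p ^ 2 / 2) hA hι hF hL1 hL hρ hm8 (by linarith) hj hK
    (by positivity) (by linarith [pow_le_pow_left₀ hp.le hsuccess 2])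
  have hmono : (p ^ 2 / 2) ^ (r * (D N + 1)) ≤ (p ^ 2 / 2) ^ 2 ^ j := by
    rw [← Real.rpow_natCast (p ^ 2 / 2)]
    exact Real.rpow_le_rpow_of_exponent_ge (by positivity) (by nlinarith) (by exact_mod_cast hjr)
  exact (hfirst.trans_le hmono).not_ge hpow

end Asymptotics

section Randomness

lemma measurableSet_isLargeIndepSet {N : ℕ} {Ω : Type*} [MeasurableSpace Ω] (ι : ℝ)
    {A : Input N → Ω → EuclideanSpace ℝ (Fin N)}
    (hA : Measurable fun p : Input N × Ω => A p.1 p.2)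
    (F : (Fin N → Option Bool) → Input N → Option (Finset (Fin N))) :
    MeasurableSet {p : Input N × Ω | IsLargeIndepSet ι p.1 (output A F p.1 p.2)} := by
  let : MeasurableSpace (Option Bool) := ⊤
  have hround : Measurable roundEntry :=
    .ite (measurableSet_le measurable_norm measurable_const) measurable_const <|
      .ite (measurableSet_le measurable_const measurable_norm) measurable_const measurable_const
  have hvec : Measurable fun p : Input N × Ω => roundVec (A p.1 p.2) :=
    measurable_pi_iff.2 fun i => hround.comp <|
      (EuclideanSpace.proj (𝕜 := ℝ) i).continuous.measurable.comp hA
  exact (measurable_fst.prodMk hvec) (Set.toFinite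
    {z : Input N × (Fin N → Option Bool) | IsLargeIndepSet ι z.1 (F z.2 z.1)}).measurableSet

lemma exists_section_integral_le_and_le_measureReal {X Ω : Type*} [MeasurableSpace X]
    [MeasurableSpace Ω] {μ : Measure X} {P : Measure Ω} [IsProbabilityMeasure μ]
    [IsProbabilityMeasure P] {g : X × Ω → ℝ} {s : Set (X × Ω)} (hs : MeasurableSet s)
    (hg0 : 0 ≤ g) (hg : Integrable g (μ.prod P)) {δ c : ℝ} (hc : 0 < c)
    (hgc : ∫ p, g p ∂μ.prod P ≤ δ / 2 * c) (hsδ : δ ≤ (μ.prod P).real s) :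
    ∃ ω, ∫ x, g (x, ω) ∂μ ≤ c ∧ δ / 2 ≤ μ.real {x | (x, ω) ∈ s} := by
  have hs_int : Integrable (s.indicator (1 : X × Ω → ℝ)) (μ.prod P) :=
    (integrable_const (1 : ℝ)).indicator hs
  have hsection (ω : Ω) : ∫ x, s.indicator 1 (x, ω) ∂μ = μ.real {x | (x, ω) ∈ s} :=
    integral_indicator_one (measurable_prodMk_right hs)
  obtain ⟨ω, hω⟩ := exists_integral_le
    (hs_int.integral_prod_right.sub (hg.integral_prod_right.div_const c))
  simp only [Pi.sub_apply] at hω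
  rw [integral_sub hs_int.integral_prod_right (hg.integral_prod_right.div_const c), integral_div,
    ← integral_prod_symm _ hs_int, ← integral_prod_symm _ hg, integral_indicator_one hs,
    hsection] at hω
  have hmean : (∫ p, g p ∂μ.prod P) / c ≤ δ / 2 := (div_le_iff₀ hc).2 hgc
  have hnonneg : 0 ≤ (∫ x, g (x, ω) ∂μ) / c := div_nonneg (integral_nonneg fun x => hg0 _) hc.le
  have hδ : 0 ≤ δ / 2 := nonneg_of_mul_nonneg_left ((integral_nonneg hg0).trans hgc) hc
  refine ⟨ω, (div_le_one hc).1 ?_, by linarith⟩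
  linarith [measureReal_le_one (μ := μ) (s := {x | (x, ω) ∈ s})]

end Randomness

end DenseIndSet

theorem corollary3p19 (ι : ℝ) (hι : 0 < ι) :
    ∃ b : ℝ, 0 < b ∧
      ∀ (C : ℝ) (D : ℕ → ℕ),
        (fun N : ℕ => (D N : ℝ)) =o[atTop] (fun N : ℕ => Real.log N ^ 2) →
      ∀ (Ω : ℕ → Type*) [∀ N, MeasurableSpace (Ω N)]
        (P : ∀ N, Measure (Ω N)) [∀ N, IsProbabilityMeasure (P N)]
        (A : ∀ N, DenseIndSet.Input N → Ω N → EuclideanSpace ℝ (Fin N)),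
        (∀ N, Measurable fun p : DenseIndSet.Input N × Ω N => A N p.1 p.2) →
        (∀ N, DenseIndSet.IsDegree (A N) (D N)) →
        (∀ᶠ N : ℕ in atTop,
          Integrable (fun p : DenseIndSet.Input N × Ω N => ‖A N p.1 p.2‖ ^ 2)
            ((DenseIndSet.gnpHalf N).prod (P N)) ∧
          ∫ p, ‖A N p.1 p.2‖ ^ 2 ∂((DenseIndSet.gnpHalf N).prod (P N)) ≤ C * Real.log N) →
      ∀ F : ∀ N, (Fin N → Option Bool) → DenseIndSet.Input N → Option (Finset (Fin N)),
        (∀ N, DenseIndSet.IsRepairing b (F N)) →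
        Tendsto
          (fun N : ℕ => ((DenseIndSet.gnpHalf N).prod (P N)).real
            {p | DenseIndSet.IsLargeIndepSet ι p.1
              (DenseIndSet.output (A N) (F N) p.1 p.2)})
          atTop (𝓝 0) := by
  refine ⟨ι / 12, by positivity, fun C D hD Ω _ P _ A hmeas hdeg hnorm F hF =>
    tendsto_order.2 ⟨fun a ha => .of_forall fun N => ha.trans_le measureReal_nonneg,
      fun δ hδ => ?_⟩⟩
  filter_upwards [DenseIndSet.eventually_success_lt hι hD (half_pos hδ)
      (show 0 < 2 * (|C| + 1) / δ by positivity), hnorm, eventually_gt_atTop 1]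
    with N hsmall ⟨hint, hle⟩ hN
  by_contra! hlarge
  have hlog : 0 < Real.log N := Real.log_pos (by exact_mod_cast hN)
  have henergy : ∫ p, ‖A N p.1 p.2‖ ^ 2 ∂((DenseIndSet.gnpHalf N).prod (P N)) ≤
      δ / 2 * (2 * (|C| + 1) / δ * Real.log N) := by
    calc _ ≤ (|C| + 1) * Real.log N := hle.trans (by gcongr; linarith [le_abs_self C])
      _ = _ := by field_simp
  obtain ⟨ω, hω, hωδ⟩ := DenseIndSet.exists_section_integral_le_and_le_measureReal
    (DenseIndSet.measurableSet_isLargeIndepSet ι (hmeas N) (F N)) (fun _ => sq_nonneg _) hint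
    (by positivity) henergy hlarge
  exact (hsmall _ _ (hdeg N ω) (hF N) hω).not_ge hωδ
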